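/- **Setting.** Consider a tabular episodic MDP with finite state space of size $S\ge1$, finite action space of size $A\ge1$, $H\ge1$ steps per episode, time-dependent transition kernels $P_h(\cdot\mid s,a)$, $h\in[H]$, and a fixed starting state $s_1$. The reachability of $s$ at step $h$ is $\delta_h(s)=\max_\pi \mathbb P^\pi(s_h=s)$, the maximum over all (stochastic, non-stationary) policies. For $p\in(0,1)$, a number of episodes $K\ge 1$ and a parameter $N$, let $$\iota_K=\log(SAHK/p),\qquad b_t=c\sqrt{H^3(\log N+\iota_K)/t},\qquad \alpha_t=\frac{H+1}{H+t}.$$ **Exploration phase of UCBZero.** Start with $\overline Q_h(s,a)=H$ and counts $N_h(s,a)=0$. In each of $K$ episodes, starting at $s_1$, at steps $h=1,\dots,H$: play $a_h\in\arg\max_a\overline Q_h(s_h,a)$ (ties broken by any, possibly randomized and history-dependent, rule), observe $s_{h+1}\sim P_h(\cdot\mid s_h,a_h)$, increase $N_h(s_h,a_h)$ by one, put $t=N_h(s_h,a_h)$, and set $$\overline Q_h(s_h,a_h)\leftarrow(1-\alpha_t)\overline Q_h(s_h,a_h)+\alpha_t\big[\overline V_{h+1}(s_{h+1})+2b_t\big],$$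 where $\overline V_{h}(s)=\min(H,\max_a\overline Q_{h}(s,a))$ for $h\le H$ and $\overline V_{H+1}=0$. **Optimistic values for a reward.** For a reward function $r_h(s,a,s')$, process the collected transitions in the same order by the same update, from the same initialization, with $r_h(s_h,a_h,s_{h+1})+V_{h+1}(s_{h+1})+b_t$ in place of $\overline V_{h+1}(s_{h+1})+2b_t$. Let $V_1^k(s_1)=\min(H,\max_aQ_1(s_1,a))$ be computed from the table at the beginning of episode $k$, and $\tilde V[r]=\frac1K\sum_{k=1}^KV_1^k(s_1)$. **Estimates.** For $(h,s,a,s')$ let $\hat P_h(s'\mid s,a)=\tilde V[R^{(1)}]/\tilde V[R^{(2)}]$, where $R^{(1)}$ is the indicator of taking action $a$ in state $s$ at step $h$ and moving to $s'$, and $R^{(2)}$ is the indicator of being in state $s$ at step $h$. **Theorem 3.** There are absolute constants $c,C>0$ such that the following holds for all such MDPs, all $p\in(0,1)$, all $\epsilon>0$, and all integers $1\le N\le 2HS^2A$ (the number of indicator rewards used). If UCBZero is run with $K$ exploration episodes, where $$K\ \ge\ 1\qquad\text{and}\qquad K\ \ge\ C\,\frac{H^5SA\,\iota_K}{\epsilon^2},$$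 then with probability at least $1-p$, for all $(h,s,a,s')$ with $\delta_h(s)>0$, $$\big|\hat P_h(s'\mid s,a)-P_h(s'\mid s,a)\big|\le\frac{\epsilon}{\delta_h(s)}.$$ Moreover such numbers of episodes exist within the claimed order: there is $K_0\ge1$ with $K_0\le 1+C\,H^5SA\,\iota_{K_0}/\epsilon^2$ such that every $K\ge K_0$ satisfies the condition on $K$. -/

import Mathlib

noncomputable section

namespace UCBZero

/-- The reward-free part of a tabular episodic MDP with `H` steps per episode: the kernels
`P h s a` (time-dependent law of the next state) and a fixed starting state.
Steps are indexed from `0`: the element `h` of `Fin H` is the `(h+1)`-st step of an episode. -/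
structure EpisodicMDP (S A : Type*) (H : ℕ) where
  P : Fin H → S → A → PMF S
  start : S

/-- A (stochastic, non-stationary) policy. -/
abbrev Policy (S A : Type*) (H : ℕ) := Fin H → S → PMF A

/-- The law of the state reached after the first `n` steps when following the policy `π` from the
starting state (constant for `n ≥ H`). -/
def stateLaw {S A : Type*} {H : ℕ} (M : EpisodicMDP S A H) (π : Policy S A H) : ℕ → PMF S
  | 0 => PMF.pure M.start
  | n + 1 =>
    if hn : n < H then
      (stateLaw M π n).bind fun s => (π ⟨n, hn⟩ s).bind fun a => M.P ⟨n, hn⟩ s a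
    else stateLaw M π n

/-- Reachability of `s` at step `h`: the maximal probability, over all policies, of being in
state `s` at step `h`. -/
def reachability {S A : Type*} {H : ℕ} (M : EpisodicMDP S A H) (h : Fin H) (s : S) : ℝ :=
  (⨆ π : Policy S A H, stateLaw M π h s).toReal

/-- One observed transition: step, state, action, next state. -/
structure Transition (S A : Type*) (H : ℕ) where
  step : Fin H
  state : S
  action : A
  next : S

/-- The tables that optimistic Q-learning maintains: action values and visit counts. -/
structure Tables (S A : Type*) (H : ℕ) where
  Q : Fin H → S → A → ℝ
  count : Fin H → S → A → ℕ

/-- Initial tables: all action values are `H`, all counts are `0`. -/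
def Tables.init (S A : Type*) (H : ℕ) : Tables S A H where
  Q := fun _ _ _ => H
  count := fun _ _ _ => 0

/-- The truncated greedy value `min(H, max_a Q_h(s,a))`. -/
def Tables.value {S A : Type*} {H : ℕ} [Fintype A] [Nonempty A]
    (T : Tables S A H) (h : Fin H) (s : S) : ℝ :=
  min (H : ℝ) (Finset.univ.sup' Finset.univ_nonempty (T.Q h s))

/-- The value at the step after `h`; it is `0` after the last step. -/
def Tables.nextValue {S A : Type*} {H : ℕ} [Fintype A] [Nonempty A]
    (T : Tables S A H) (h : Fin H) (s : S) : ℝ :=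
  if hn : (h : ℕ) + 1 < H then T.value ⟨h + 1, hn⟩ s else 0

/-- The learning rate `α_t = (H+1)/(H+t)`. -/
def learningRate (H t : ℕ) : ℝ := ((H : ℝ) + 1) / ((H : ℝ) + t)

open Classical in
/-- The optimistic Q-learning update at one transition `x`, with reward function `r` and bonus
`b t` at the `t`-th visit:
`Q_h(s,a) ← (1 - α_t) Q_h(s,a) + α_t (r_h(s,a,s') + V_{h+1}(s') + b_t)`. -/
def Tables.update {S A : Type*} {H : ℕ} [Fintype A] [Nonempty A]
    (b : ℕ → ℝ) (r : Fin H → S → A → S → ℝ) (T : Tables S A H) (x : Transition S A H) :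
    Tables S A H where
  Q := fun h s a =>
    if h = x.step ∧ s = x.state ∧ a = x.action then
      (1 - learningRate H (T.count h s a + 1)) * T.Q h s a
        + learningRate H (T.count h s a + 1)
          * (r h s a x.next + T.nextValue h x.next + b (T.count h s a + 1))
    else T.Q h s a
  count := fun h s a =>
    if h = x.step ∧ s = x.state ∧ a = x.action then T.count h s a + 1 else T.count h s a

/-- The tables after processing a list of transitions in chronological order. -/
def learn {S A : Type*} {H : ℕ} [Fintype A] [Nonempty A]
    (b : ℕ → ℝ) (r : Fin H → S → A → S → ℝ) (L : List (Transition S A H)) : Tables S A H :=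
  L.foldl (Tables.update b r) (Tables.init S A H)

/-- The log factor `ι = log(S A H K / p)`. -/
def logFactor (nS nA H K : ℕ) (p : ℝ) : ℝ :=
  Real.log ((nS : ℝ) * nA * H * K / p)

/-- The bonus `b_t = c √(H³ (log N + ι) / t)`. -/
def bonus (c : ℝ) (nS nA H K N : ℕ) (p : ℝ) (t : ℕ) : ℝ :=
  c * Real.sqrt ((H : ℝ) ^ 3 * (Real.log N + logFactor nS nA H K p) / t)

/-- The pseudo-Q tables of the exploration phase after the transitions `L`: zero reward and
bonus `2 b_t`. -/
def pseudoTables {S A : Type*} {H : ℕ} [Fintype A] [Nonempty A]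
    (b : ℕ → ℝ) (L : List (Transition S A H)) : Tables S A H :=
  learn (fun t => 2 * b t) (fun _ _ _ _ => 0) L

/-- A (possibly randomized) rule for choosing the next action from all transitions observed so
far, the current step and the current state. -/
abbrev ActionRule (S A : Type*) (H : ℕ) := List (Transition S A H) → Fin H → S → PMF A

/-- The rule always plays a maximizer of the current pseudo-Q table; ties are broken
arbitrarily. -/
def IsGreedy {S A : Type*} {H : ℕ} [Fintype A] [Nonempty A]
    (b : ℕ → ℝ) (act : ActionRule S A H) : Prop :=
  ∀ (L : List (Transition S A H)) (h : Fin H) (s : S), ∀ a ∈ (act L h s).support,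
    ∀ a' : A, (pseudoTables b L).Q h s a' ≤ (pseudoTables b L).Q h s a

/-- The law of the first `n` steps of a new episode, after the transitions `L` of the earlier
episodes: the transitions of these steps and the current state. -/
def rollout {S A : Type*} {H : ℕ} (M : EpisodicMDP S A H) (act : ActionRule S A H)
    (L : List (Transition S A H)) : ℕ → PMF (List (Transition S A H) × S)
  | 0 => PMF.pure ([], M.start)
  | n + 1 =>
    if hn : n < H then
      (rollout M act L n).bind fun es =>
        (act (L ++ es.1) ⟨n, hn⟩ es.2).bind fun a =>
          (M.P ⟨n, hn⟩ es.2 a).map fun s' => (es.1 ++ [⟨⟨n, hn⟩, es.2, a, s'⟩], s')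
    else rollout M act L n

/-- The law of the data of `K` exploration episodes, as a chronological list of episodes. -/
def explore {S A : Type*} {H : ℕ} (M : EpisodicMDP S A H) (act : ActionRule S A H) :
    ℕ → PMF (List (List (Transition S A H)))
  | 0 => PMF.pure []
  | k + 1 =>
    (explore M act k).bind fun D => (rollout M act D.flatten H).map fun es => D ++ [es.1]

/-- The average over the episodes `k = 1, …, K` of `V_1^k(s₁)`, where `V^k` is the optimistic value
at the beginning of episode `k` of the policy-optimization phase, run on the data `D` with
rewards `r` and bonus `b`. -/
def averageValue {S A : Type*} {H : ℕ} [Fintype A] [Nonempty A] (b : ℕ → ℝ) (K : ℕ)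
    (D : List (List (Transition S A H))) (r : Fin H → S → A → S → ℝ) (hH : 0 < H) (s₁ : S) : ℝ :=
  (∑ k ∈ Finset.range K, (learn b r (D.take k).flatten).value ⟨0, hH⟩ s₁) / K

open Classical in
/-- The reward function that indicates the transition `(h, s, a, s')`. -/
def transitionReward {S A : Type*} {H : ℕ} (h : Fin H) (s : S) (a : A) (s' : S) :
    Fin H → S → A → S → ℝ :=
  fun g x y x' => if g = h ∧ x = s ∧ y = a ∧ x' = s' then 1 else 0

open Classical in
/-- The reward function that indicates the state `s` at step `h`. -/
def stateReward {S A : Type*} {H : ℕ} (h : Fin H) (s : S) : Fin H → S → A → S → ℝ :=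
  fun g x _ _ => if g = h ∧ x = s then 1 else 0

/-- The estimate of `P_h(s' | s, a)`: the ratio of the average optimistic values for the
two indicator reward functions. -/
def modelEstimate {S A : Type*} {H : ℕ} [Fintype A] [Nonempty A] (b : ℕ → ℝ) (K : ℕ)
    (D : List (List (Transition S A H))) (s₁ : S) (h : Fin H) (s : S) (a : A) (s' : S) : ℝ :=
  averageValue b K D (transitionReward h s a s') h.pos s₁ /
    averageValue b K D (stateReward h s) h.pos s₁

/-- The number of episodes `C H⁵ S A ι / ε²`. -/
def episodeBound (C : ℝ) (nS nA H K : ℕ) (p ε : ℝ) : ℝ :=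
  C * ((H : ℝ) ^ 5 * nS * nA * logFactor nS nA H K p / ε ^ 2)

end UCBZero

end

/-!
For a fixed reward, the Q-learning update averages the noise of the sampled targets with weights
whose squares sum to at most `2H/t` after `t` visits. By Azuma's inequality and a union bound, with
probability at least `1 - p` the bonus dominates this averaged noise at every visit, simultaneously
for all indicator rewards. On this event the tables learned with a reward are optimistic, and they
exceed the optimal values by at most the pseudo-values of the exploration phase, which are learned
with zero reward and twice the bonus. Since exploration is greedy for the pseudo-values, a potential
over the tables telescopes along each episode and bounds the sum over `K` episodes of the
pseudo-values of the starting state by `3 S A H² + 12 β H √(S A K)`, where `β / √t` is the bonus;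
this is at most `ε K` for the required `K`.

The optimal value of the indicator of `(h, s)` is the reachability `δ` of `s` at step `h`, and that
of the indicator of `(h, s, a, s')` is `P δ`. The averaged optimistic values therefore lie in
`[δ, δ + ε]` and `[P δ, P δ + ε]`, and their ratio differs from `P` by at most `ε / δ`.
-/

noncomputable section

namespace UCBZero

open scoped ENNReal

section Laws

variable {α β ι : Type*}

/-- The expectation of a nonnegative function under a discrete law. -/
def expect (q : PMF α) (f : α → ℝ≥0∞) : ℝ≥0∞ := ∑' x, q x * f x

theorem expect_pure (a : α) (f : α → ℝ≥0∞) : expect (PMF.pure a) f = f a := by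
  classical
  rw [expect, tsum_eq_single a fun b hb => by simp [hb]]
  simp

theorem expect_bind (q : PMF α) (g : α → PMF β) (f : β → ℝ≥0∞) :
    expect (q.bind g) f = expect q fun a => expect (g a) f := by
  unfold expect
  simp_rw [PMF.bind_apply, ← ENNReal.tsum_mul_right, ← ENNReal.tsum_mul_left]
  rw [ENNReal.tsum_comm]
  simp_rw [mul_assoc]

theorem expect_map (q : PMF α) (g : α → β) (f : β → ℝ≥0∞) :
    expect (q.map g) f = expect q fun a => f (g a) := by
  simp [PMF.map, expect_bind, expect_pure]

theorem expect_const (q : PMF α) (c : ℝ≥0∞) : expect q (fun _ => c) = c := by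
  simp [expect, ENNReal.tsum_mul_right]

theorem expect_mono (q : PMF α) {f g : α → ℝ≥0∞} (hfg : ∀ x, f x ≤ g x) :
    expect q f ≤ expect q g :=
  ENNReal.tsum_le_tsum fun x => by gcongr; exact hfg x

theorem expect_le (q : PMF α) {f : α → ℝ≥0∞} {c : ℝ≥0∞} (hf : ∀ x, f x ≤ c) :
    expect q f ≤ c :=
  (expect_mono q hf).trans (expect_const q c).le

theorem sum_toReal_apply [Fintype α] (q : PMF α) : ∑ x, (q x).toReal = 1 := by
  rw [← ENNReal.toReal_sum fun x _ => q.apply_ne_top x, ← tsum_fintype (L := .unconditional α),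
    q.tsum_coe, ENNReal.toReal_one]

theorem toReal_apply_le_one (q : PMF α) (x : α) : (q x).toReal ≤ 1 :=
  ENNReal.toReal_le_of_le_ofReal zero_le_one (by simpa using q.coe_le_one x)

theorem toReal_expect [Fintype α] (q : PMF α) {f : α → ℝ≥0∞} (hf : ∀ x, f x ≠ ∞) :
    (expect q f).toReal = ∑ x, (q x).toReal * (f x).toReal := by
  rw [expect, tsum_fintype,
    ENNReal.toReal_sum fun x _ => ENNReal.mul_ne_top (q.apply_ne_top x) (hf x)]
  simp_rw [ENNReal.toReal_mul]

theorem expect_ofReal [Fintype α] (q : PMF α) {f : α → ℝ} (hf : ∀ x, 0 ≤ f x) :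
    expect q (fun x => ENNReal.ofReal (f x)) = ENNReal.ofReal (∑ x, (q x).toReal * f x) := by
  rw [expect, tsum_fintype,
    ENNReal.ofReal_sum_of_nonneg fun x _ => mul_nonneg ENNReal.toReal_nonneg (hf x)]
  refine Finset.sum_congr rfl fun x _ => ?_
  rw [ENNReal.ofReal_mul ENNReal.toReal_nonneg, ENNReal.ofReal_toReal (q.apply_ne_top x)]

theorem toOuterMeasure_ge_le_expect_div (q : PMF α) (f : α → ℝ≥0∞) {a : ℝ≥0∞}
    (ha : a ≠ 0) (ha' : a ≠ ∞) : q.toOuterMeasure {x | a ≤ f x} ≤ expect q f / a := by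
  rw [ENNReal.le_div_iff_mul_le (Or.inl ha) (Or.inl ha'), PMF.toOuterMeasure_apply,
    ← ENNReal.tsum_mul_right]
  refine ENNReal.tsum_le_tsum fun x => ?_
  by_cases hx : a ≤ f x
  · rw [Set.indicator_of_mem (by exact hx)]
    gcongr
  · rw [Set.indicator_of_notMem (by exact hx), zero_mul]
    exact zero_le

theorem toOuterMeasure_exists_le [Fintype ι] (q : PMF α) {E : ι → α → Prop} {c : ℝ≥0∞}
    (hE : ∀ i, q.toOuterMeasure {x | E i x} ≤ c) :
    q.toOuterMeasure {x | ∃ i, E i x} ≤ Fintype.card ι * c := by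
  rw [Set.ofPred_exists]
  calc q.toOuterMeasure (⋃ i, {x | E i x}) ≤ ∑ i, q.toOuterMeasure {x | E i x} :=
        MeasureTheory.measure_iUnion_fintype_le _ _
    _ ≤ ∑ _i : ι, c := Finset.sum_le_sum fun i _ => hE i
    _ = Fintype.card ι * c := by simp

theorem ofReal_one_sub_le_toOuterMeasure (q : PMF α) {p : ℝ} (hp : 0 ≤ p) {s : Set α}
    (hs : q.toOuterMeasure sᶜ ≤ ENNReal.ofReal p) :
    ENNReal.ofReal (1 - p) ≤ q.toOuterMeasure s := by
  rw [ENNReal.ofReal_sub 1 hp, ENNReal.ofReal_one, tsub_le_iff_right]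
  calc (1 : ℝ≥0∞) = q.toOuterMeasure (s ∪ sᶜ) := by
        rw [Set.union_compl_self, (q.toOuterMeasure_apply_eq_one_iff _).2 (Set.subset_univ _)]
    _ ≤ q.toOuterMeasure s + q.toOuterMeasure sᶜ := MeasureTheory.measure_union_le _ _
    _ ≤ q.toOuterMeasure s + ENNReal.ofReal p := by gcongr

end Laws

section Exploration

variable {S A : Type*} {H : ℕ} {M : EpisodicMDP S A H}

/-- The function `F` of the data does not grow on average when one more transition is observed,
whatever the data, the step, the state and the action. -/
def IsSupermartingale (M : EpisodicMDP S A H) (F : List (Transition S A H) → ℝ≥0∞) : Prop :=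
  ∀ (L : List (Transition S A H)) (h : Fin H) (s : S) (a : A),
    expect (M.P h s a) (fun s' => F (L ++ [⟨h, s, a, s'⟩])) ≤ F L

theorem IsSupermartingale.expect_rollout_le {F : List (Transition S A H) → ℝ≥0∞}
    (hF : IsSupermartingale M F) (act : ActionRule S A H) (L : List (Transition S A H)) (n : ℕ) :
    expect (rollout M act L n) (fun es => F (L ++ es.1)) ≤ F L := by
  induction n with
  | zero => simp [rollout, expect_pure]
  | succ n ih =>
    by_cases hn : n < H
    · simp only [rollout, hn, dif_pos, expect_bind, expect_map]
      refine (expect_mono _ fun es => expect_le _ fun a => ?_).trans ih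
      simpa only [List.append_assoc] using hF (L ++ es.1) ⟨n, hn⟩ es.2 a
    · simpa only [rollout, hn, dif_neg, not_false_eq_true] using ih

theorem IsSupermartingale.expect_explore_le {F : List (Transition S A H) → ℝ≥0∞}
    (hF : IsSupermartingale M F) (act : ActionRule S A H) (K : ℕ) :
    expect (explore M act K) (fun D => F D.flatten) ≤ F [] := by
  induction K with
  | zero => simp [explore, expect_pure]
  | succ k ih =>
    simp only [explore, expect_bind, expect_map]
    refine (expect_mono _ fun D => ?_).trans ih
    simpa using hF.expect_rollout_le act D.flatten H

theorem mem_support_rollout_succ {act : ActionRule S A H} {L : List (Transition S A H)} {n : ℕ}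
    (hn : n < H) {es : List (Transition S A H) × S} :
    es ∈ (rollout M act L (n + 1)).support ↔
      ∃ es₀ ∈ (rollout M act L n).support, ∃ a ∈ (act (L ++ es₀.1) ⟨n, hn⟩ es₀.2).support,
        ∃ s' ∈ (M.P ⟨n, hn⟩ es₀.2 a).support, (es₀.1 ++ [⟨⟨n, hn⟩, es₀.2, a, s'⟩], s') = es := by
  simp only [rollout, hn, dif_pos, PMF.mem_support_bind_iff, PMF.mem_support_map_iff]

theorem mem_support_explore_succ {act : ActionRule S A H} {k : ℕ}
    {D : List (List (Transition S A H))} :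
    D ∈ (explore M act (k + 1)).support ↔
      ∃ D₀ ∈ (explore M act k).support, ∃ es ∈ (rollout M act D₀.flatten H).support,
        D₀ ++ [es.1] = D := by
  simp only [explore, PMF.mem_support_bind_iff, PMF.mem_support_map_iff]

theorem length_of_mem_support_rollout {act : ActionRule S A H} {L : List (Transition S A H)}
    {n : ℕ} (hn : n ≤ H) {es : List (Transition S A H) × S}
    (hes : es ∈ (rollout M act L n).support) : es.1.length = n := by
  induction n generalizing es with
  | zero => simp_all [rollout]
  | succ n ih =>
    obtain ⟨es₀, h₀, a, -, s', -, rfl⟩ := (mem_support_rollout_succ hn).1 hes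
    simp [ih (by omega) h₀]

theorem length_of_mem_support_explore {act : ActionRule S A H} {K : ℕ}
    {D : List (List (Transition S A H))} (hD : D ∈ (explore M act K).support) :
    D.length = K := by
  induction K generalizing D with
  | zero => simp_all [explore]
  | succ k ih =>
    obtain ⟨D₀, h₀, es, -, rfl⟩ := mem_support_explore_succ.1 hD
    simp [ih h₀]

theorem length_flatten_of_mem_support_explore {act : ActionRule S A H} {K : ℕ}
    {D : List (List (Transition S A H))} (hD : D ∈ (explore M act K).support) :
    D.flatten.length = K * H := by
  induction K generalizing D with
  | zero => simp_all [explore]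
  | succ k ih =>
    obtain ⟨D₀, h₀, es, hes, rfl⟩ := mem_support_explore_succ.1 hD
    rw [List.flatten_append, List.length_append, ih h₀]
    simp [length_of_mem_support_rollout le_rfl hes, Nat.succ_mul]

end Exploration

section Averaging

/-! ### Averages with the learning rates -/

variable {α : Type*} {H t : ℕ}

/-- The sum of `u (i + 1) * X x` over the entries `x` of a list, `i` being the position of `x`;
the weight of the `i`-th entry is `u i` when entries are counted from `1`, as visits are. -/
def weightedSum (u : ℕ → ℝ) (X : α → ℝ) (l : List α) : ℝ :=
  (l.mapIdx fun i x => u (i + 1) * X x).sum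

@[simp]
theorem weightedSum_nil (u : ℕ → ℝ) (X : α → ℝ) : weightedSum u X [] = 0 := rfl

theorem weightedSum_concat (u : ℕ → ℝ) (X : α → ℝ) (l : List α) (x : α) :
    weightedSum u X (l ++ [x]) = weightedSum u X l + u (l.length + 1) * X x := by
  simp [weightedSum]

theorem weightedSum_congr {u v : ℕ → ℝ} (X : α → ℝ) (l : List α)
    (huv : ∀ i ≤ l.length, u i = v i) : weightedSum u X l = weightedSum v X l := by
  induction l using List.reverseRecOn with
  | nil => rfl
  | append_singleton l x ih =>
    rw [weightedSum_concat, weightedSum_concat, ih fun i hi => huv i (by simp; omega),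
      huv (l.length + 1) (by simp)]

theorem weightedSum_mul_left (c : ℝ) (u : ℕ → ℝ) (X : α → ℝ) (l : List α) :
    weightedSum (fun i => c * u i) X l = c * weightedSum u X l := by
  induction l using List.reverseRecOn with
  | nil => simp
  | append_singleton l x ih => rw [weightedSum_concat, weightedSum_concat, ih]; ring

theorem weightedSum_append_of_eq_zero {u : ℕ → ℝ} (X : α → ℝ) {l : List α}
    (hu : ∀ i, l.length < i → u i = 0) (l' : List α) :
    weightedSum u X (l ++ l') = weightedSum u X l := by
  induction l' using List.reverseRecOn with
  | nil => simp
  | append_singleton l' x ih =>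
    rw [← List.append_assoc, weightedSum_concat, ih, hu _ (by rw [List.length_append]; omega),
      zero_mul, add_zero]

theorem learningRate_one : learningRate H 1 = 1 := by
  rw [learningRate, Nat.cast_one, div_self (by positivity)]

theorem learningRate_nonneg : 0 ≤ learningRate H t := by
  unfold learningRate
  positivity

theorem one_sub_learningRate (H t : ℕ) : 1 - learningRate H (t + 1) = t / (H + t + 1) := by
  unfold learningRate
  push_cast
  have : (H : ℝ) + (t + 1) ≠ 0 := by positivity
  field_simp
  ring

theorem learningRate_succ_le_one : learningRate H (t + 1) ≤ 1 := by
  rw [← sub_nonneg, one_sub_learningRate]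
  positivity

/-- The weight `α_t^i = α_i ∏_{j=i+1}^t (1 - α_j)` of the `i`-th target after `t` updates. -/
def weight (H : ℕ) : ℕ → ℕ → ℝ
  | 0, _ => 0
  | t + 1, i =>
    if i = t + 1 then learningRate H (t + 1) else (1 - learningRate H (t + 1)) * weight H t i

theorem weight_eq_zero {i : ℕ} (hi : t < i) : weight H t i = 0 := by
  induction t with
  | zero => rfl
  | succ t ih => rw [weight, if_neg (by omega), ih (by omega), mul_zero]

theorem sum_weight_sq_succ (H t n : ℕ) :
    ∑ i ∈ Finset.range n, weight H (t + 1) (i + 1) ^ 2 ≤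
      (1 - learningRate H (t + 1)) ^ 2 * ∑ i ∈ Finset.range n, weight H t (i + 1) ^ 2
        + learningRate H (t + 1) ^ 2 := by
  have hterm : ∀ i, weight H (t + 1) (i + 1) ^ 2 =
      (1 - learningRate H (t + 1)) ^ 2 * weight H t (i + 1) ^ 2
        + if i = t then learningRate H (t + 1) ^ 2 else 0 := fun i => by
    by_cases hi : i = t
    · simp [weight, hi, weight_eq_zero]
    · simp [weight, hi, mul_pow]
  simp_rw [hterm, Finset.sum_add_distrib, ← Finset.mul_sum, Finset.sum_ite_eq']
  gcongr
  split_ifs <;> first | rfl | positivity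

theorem sum_weight_sq_le (hH : 0 < H) (t n : ℕ) :
    ∑ i ∈ Finset.range n, weight H t (i + 1) ^ 2 ≤ 2 * H / t := by
  induction t with
  | zero => simp [weight]
  | succ t ih =>
    have hH' : (1 : ℝ) ≤ H := by exact_mod_cast hH
    have hpoly : (2 * H * t + (H + 1) ^ 2) * (t + 1) ≤ 2 * (H : ℝ) * (H + t + 1) ^ 2 := by
      have : 0 ≤ 2 * (H : ℝ) ^ 3 + (t + 1) * (3 * H ^ 2 - 1) := by
        have : 0 ≤ 3 * (H : ℝ) ^ 2 - 1 := by nlinarith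
        positivity
      linarith
    calc ∑ i ∈ Finset.range n, weight H (t + 1) (i + 1) ^ 2
        ≤ (1 - learningRate H (t + 1)) ^ 2 * (2 * H / t) + learningRate H (t + 1) ^ 2 := by
          refine (sum_weight_sq_succ H t n).trans ?_
          gcongr
      _ = (2 * H * t + (H + 1) ^ 2) / (H + t + 1) ^ 2 := by
          rw [one_sub_learningRate, learningRate]
          push_cast
          rcases eq_or_ne (t : ℝ) 0 with ht | ht
          · simp [ht, div_pow]
          · field_simp
            ring
      _ ≤ 2 * H / (t + 1 : ℕ) := by
          push_cast
          rwa [div_le_div_iff₀ (by positivity) (by positivity)]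

/-- The average of the values of `X` along a list that results from updating `0` towards each of
them with the learning rates. -/
def recAverage (H : ℕ) (X : α → ℝ) (l : List α) : ℝ :=
  weightedSum (weight H l.length) X l

theorem recAverage_concat (H : ℕ) (X : α → ℝ) (l : List α) (x : α) :
    recAverage H X (l ++ [x]) = (1 - learningRate H (l.length + 1)) * recAverage H X l
      + learningRate H (l.length + 1) * X x := by
  rw [recAverage, weightedSum_concat, recAverage, ← weightedSum_mul_left]
  congr 1
  · refine weightedSum_congr _ _ fun i hi => ?_
    rw [List.length_append, List.length_singleton, weight, if_neg (by omega)]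
  · simp [weight]

theorem weightedSum_weight_eq_recAverage_take (X : α → ℝ) {l : List α} (ht : t ≤ l.length) :
    weightedSum (weight H t) X l = recAverage H X (l.take t) := by
  have hlen : (l.take t).length = t := List.length_take_of_le ht
  conv_lhs => rw [← List.take_append_drop t l]
  rw [weightedSum_append_of_eq_zero X (fun i hi => weight_eq_zero (hlen ▸ hi)), recAverage, hlen]

end Averaging

section Concentration

/-! ### Concentration of the weighted noise -/

variable {S A : Type*} {H : ℕ} {M : EpisodicMDP S A H}

open Classical in
/-- The next states observed at the visits of `(h, s, a)`, in chronological order. -/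
def nexts (h : Fin H) (s : S) (a : A) (L : List (Transition S A H)) : List S :=
  (L.filter fun x => h = x.step ∧ s = x.state ∧ a = x.action).map Transition.next

theorem nexts_append (h : Fin H) (s : S) (a : A) (L L' : List (Transition S A H)) :
    nexts h s a (L ++ L') = nexts h s a L ++ nexts h s a L' := by
  simp [nexts]

open Classical in
theorem nexts_concat (h : Fin H) (s : S) (a : A) (L : List (Transition S A H))
    (x : Transition S A H) :
    nexts h s a (L ++ [x]) =
      if h = x.step ∧ s = x.state ∧ a = x.action then nexts h s a L ++ [x.next]
      else nexts h s a L := by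
  rw [nexts_append]
  split_ifs with hx <;> simp [nexts, hx]

theorem length_nexts_le (h : Fin H) (s : S) (a : A) (L : List (Transition S A H)) :
    (nexts h s a L).length ≤ L.length := by
  simpa [nexts] using List.length_filter_le _ _

theorem sum_mul_exp_le [Fintype S] (q : PMF S) {X : S → ℝ} (hX : ∀ x, |X x| ≤ 1)
    (hq : ∑ x, (q x).toReal * X x = 0) (θ : ℝ) :
    ∑ x, (q x).toReal * Real.exp (θ * X x) ≤ Real.exp (θ ^ 2 / 2) := by
  calc ∑ x, (q x).toReal * Real.exp (θ * X x)
      ≤ ∑ x, (q x).toReal * (Real.cosh θ + X x * Real.sinh θ) := by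
        refine Finset.sum_le_sum fun x _ => ?_
        rw [mul_comm θ]
        gcongr
        exact Real.exp_mul_le_cosh_add_mul_sinh (hX x) θ
    _ = Real.cosh θ * ∑ x, (q x).toReal + Real.sinh θ * ∑ x, (q x).toReal * X x := by
        rw [Finset.mul_sum, Finset.mul_sum, ← Finset.sum_add_distrib]
        exact Finset.sum_congr rfl fun x _ => by ring
    _ = Real.cosh θ := by rw [sum_toReal_apply, hq, mul_one, mul_zero, add_zero]
    _ ≤ Real.exp (θ ^ 2 / 2) := Real.cosh_le_exp_half_sq θ

theorem expect_exp_add_mul_le [Fintype S] (q : PMF S) {X : S → ℝ} (hX : ∀ x, |X x| ≤ 1)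
    (hq : ∑ x, (q x).toReal * X x = 0) (c θ : ℝ) :
    expect q (fun x => ENNReal.ofReal (Real.exp (c + θ * X x))) ≤
      ENNReal.ofReal (Real.exp (c + θ ^ 2 / 2)) := by
  rw [expect_ofReal q fun x => Real.exp_nonneg _]
  refine ENNReal.ofReal_le_ofReal ?_
  simp_rw [Real.exp_add, mul_left_comm _ (Real.exp c), ← Finset.mul_sum]
  gcongr
  exact sum_mul_exp_le q hX hq θ

theorem isSupermartingale_exp [Fintype S] {h : Fin H} {s : S} {a : A} {X : S → ℝ}
    (hX : ∀ x, |X x| ≤ 1) (hP : ∑ x, (M.P h s a x).toReal * X x = 0) (u : ℕ → ℝ) :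
    IsSupermartingale M fun L => ENNReal.ofReal (Real.exp (weightedSum u X (nexts h s a L)
      - (∑ i ∈ Finset.range (nexts h s a L).length, u (i + 1) ^ 2) / 2)) := by
  intro L g y b
  by_cases hx : h = g ∧ s = y ∧ a = b
  · obtain ⟨rfl, rfl, rfl⟩ := hx
    simp only [nexts_concat, and_self, if_true, weightedSum_concat, List.length_append,
      List.length_singleton, Finset.sum_range_succ]
    set n := (nexts h s a L).length
    set Z := weightedSum u X (nexts h s a L)
    set V := ∑ i ∈ Finset.range n, u (i + 1) ^ 2
    convert expect_exp_add_mul_le (M.P h s a) hX hP (Z - (V + u (n + 1) ^ 2) / 2) (u (n + 1))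
      using 5 <;> ring
  · simp only [nexts_concat, hx, if_false, expect_const, le_refl]

theorem toOuterMeasure_weightedSum_ge_le [Fintype S] (act : ActionRule S A H) (K : ℕ) {h : Fin H}
    {s : S} {a : A} {X : S → ℝ} (hX : ∀ x, |X x| ≤ 1)
    (hP : ∑ x, (M.P h s a x).toReal * X x = 0) {u : ℕ → ℝ} {v : ℝ}
    (hu : ∀ n, ∑ i ∈ Finset.range n, u (i + 1) ^ 2 ≤ v) (hv : 0 < v) {z : ℝ} (hz : 0 ≤ z) :
    (explore M act K).toOuterMeasure {D | z ≤ weightedSum u X (nexts h s a D.flatten)} ≤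
      ENNReal.ofReal (Real.exp (-(z ^ 2 / (2 * v)))) := by
  set θ : ℝ := z / v with hθ
  set e : ℝ := z ^ 2 / (2 * v) with he
  have hθe : θ * z - θ ^ 2 * v / 2 = e := by rw [hθ, he]; field_simp; ring
  set F : List (Transition S A H) → ℝ≥0∞ := fun L => ENNReal.ofReal (Real.exp
    (weightedSum (fun i => θ * u i) X (nexts h s a L)
      - (∑ i ∈ Finset.range (nexts h s a L).length, (θ * u (i + 1)) ^ 2) / 2)) with hF
  have hF_nil : F [] = 1 := by simp [hF, nexts]
  have hle : ∀ D : List (List (Transition S A H)),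
      z ≤ weightedSum u X (nexts h s a D.flatten) →
        ENNReal.ofReal (Real.exp e) ≤ F D.flatten := fun D hD => by
    rw [hF]
    refine ENNReal.ofReal_le_ofReal (Real.exp_le_exp.2 ?_)
    simp_rw [weightedSum_mul_left, mul_pow, ← Finset.mul_sum]
    rw [← hθe]
    gcongr
    exact hu _
  calc (explore M act K).toOuterMeasure {D | z ≤ weightedSum u X (nexts h s a D.flatten)}
      ≤ (explore M act K).toOuterMeasure {D | ENNReal.ofReal (Real.exp e) ≤ F D.flatten} :=
        (explore M act K).toOuterMeasure.mono hle
    _ ≤ expect (explore M act K) (fun D => F D.flatten) / ENNReal.ofReal (Real.exp e) :=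
        toOuterMeasure_ge_le_expect_div _ _ (by simp [Real.exp_pos]) ENNReal.ofReal_ne_top
    _ ≤ 1 / ENNReal.ofReal (Real.exp e) := by
        gcongr
        exact ((isSupermartingale_exp hX hP _).expect_explore_le act K).trans_eq hF_nil
    _ = ENNReal.ofReal (Real.exp (-e)) := by
        rw [Real.exp_neg, ENNReal.ofReal_inv_of_pos (Real.exp_pos _), one_div]

theorem toOuterMeasure_abs_weightedSum_ge_le [Fintype S] (act : ActionRule S A H) (K : ℕ)
    {h : Fin H} {s : S} {a : A} {X : S → ℝ} (hX : ∀ x, |X x| ≤ 1)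
    (hP : ∑ x, (M.P h s a x).toReal * X x = 0) {u : ℕ → ℝ} {v : ℝ}
    (hu : ∀ n, ∑ i ∈ Finset.range n, u (i + 1) ^ 2 ≤ v) (hv : 0 < v) {z : ℝ} (hz : 0 ≤ z) :
    (explore M act K).toOuterMeasure {D | z ≤ |weightedSum u X (nexts h s a D.flatten)|} ≤
      2 * ENNReal.ofReal (Real.exp (-(z ^ 2 / (2 * v)))) := by
  have hneg := toOuterMeasure_weightedSum_ge_le (u := fun i => -1 * u i) act K hX hP
    (by simpa using hu) hv hz
  simp_rw [weightedSum_mul_left, neg_one_mul] at hneg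
  simp_rw [le_abs, Set.ofPred_or]
  rw [two_mul (ENNReal.ofReal _)]
  exact (MeasureTheory.measure_union_le _ _).trans
    (add_le_add (toOuterMeasure_weightedSum_ge_le act K hX hP hu hv hz) hneg)

end Concentration

section Noise

/-! ### Optimism -/

/-- The average of the bonuses `b 1, …, b t` with the learning rates. -/
def avgBonus (H : ℕ) (b : ℕ → ℝ) : ℕ → ℝ
  | 0 => 0
  | t + 1 => (1 - learningRate H (t + 1)) * avgBonus H b t + learningRate H (t + 1) * b (t + 1)

theorem le_avgBonus {H : ℕ} {b : ℕ → ℝ} (hb : AntitoneOn b (Set.Ici 1)) {t : ℕ} (ht : 1 ≤ t) :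
    b t ≤ avgBonus H b t := by
  induction t, ht using Nat.le_induction with
  | base => simp [avgBonus, learningRate_one]
  | succ t ht ih =>
    have hstep : b (t + 1) ≤ avgBonus H b t :=
      (hb (Set.mem_Ici.2 ht) (Set.mem_Ici.2 (by omega)) t.le_succ).trans ih
    have hrate : 0 ≤ 1 - learningRate H (t + 1) := sub_nonneg.2 learningRate_succ_le_one
    rw [avgBonus]
    linarith [mul_le_mul_of_nonneg_left hstep hrate]

/-- The bonus `β / √t` at the `t`-th visit, with scale `β`. -/
def sqrtBonus (β : ℝ) (t : ℕ) : ℝ := β / √t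

theorem sqrtBonus_nonneg {β : ℝ} (hβ : 0 ≤ β) (t : ℕ) : 0 ≤ sqrtBonus β t := by
  unfold sqrtBonus
  positivity

theorem antitoneOn_sqrtBonus {β : ℝ} (hβ : 0 ≤ β) : AntitoneOn (sqrtBonus β) (Set.Ici 1) := by
  intro t ht t' _ htt'
  have : (0 : ℝ) < t := by exact_mod_cast Set.mem_Ici.1 ht
  unfold sqrtBonus
  gcongr

variable {S A : Type*} {H : ℕ} [Fintype S] {M : EpisodicMDP S A H} {r : Fin H → S → A → S → ℝ}
  {V : ℕ → S → ℝ} {b : ℕ → ℝ} {L : List (Transition S A H)}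

/-- The expected return of playing `a` in state `s` at step `h` and continuing with the values
`V`. -/
def actionValue (M : EpisodicMDP S A H) (r : Fin H → S → A → S → ℝ) (V : ℕ → S → ℝ) (h : Fin H)
    (s : S) (a : A) : ℝ :=
  ∑ s', (M.P h s a s').toReal * (r h s a s' + V (h + 1) s')

/-- The difference between the sampled and the expected return of one step. -/
def noise (M : EpisodicMDP S A H) (r : Fin H → S → A → S → ℝ) (V : ℕ → S → ℝ) (h : Fin H)
    (s : S) (a : A) (s' : S) : ℝ :=
  r h s a s' + V (h + 1) s' - actionValue M r V h s a

theorem sum_noise (M : EpisodicMDP S A H) (r : Fin H → S → A → S → ℝ) (V : ℕ → S → ℝ) (h : Fin H)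
    (s : S) (a : A) : ∑ s', (M.P h s a s').toReal * noise M r V h s a s' = 0 := by
  simp only [noise, mul_sub, Finset.sum_sub_distrib, ← Finset.sum_mul, sum_toReal_apply, one_mul]
  rw [actionValue, sub_self]

/-- At the `t`-th visit of every `(h, s, a)` in the data `L`, the noise averaged with the learning
rates is at most `b t` in absolute value. -/
def IsNoiseBounded (M : EpisodicMDP S A H) (r : Fin H → S → A → S → ℝ) (V : ℕ → S → ℝ)
    (b : ℕ → ℝ) (L : List (Transition S A H)) : Prop :=
  ∀ (h : Fin H) (s : S) (a : A) (t : ℕ), 1 ≤ t → t ≤ (nexts h s a L).length →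
    |recAverage H (noise M r V h s a) ((nexts h s a L).take t)| ≤ b t

theorem IsNoiseBounded.of_append {L' : List (Transition S A H)}
    (hL : IsNoiseBounded M r V b (L ++ L')) : IsNoiseBounded M r V b L := by
  intro h s a t ht htL
  have := hL h s a t ht (by rw [nexts_append, List.length_append]; omega)
  rwa [nexts_append, List.take_append_of_le_length htL] at this

theorem IsNoiseBounded.abs_recAverage_le (hL : IsNoiseBounded M r V b L)
    (hb : AntitoneOn b (Set.Ici 1)) (h : Fin H) (s : S) (a : A) :
    |recAverage H (noise M r V h s a) (nexts h s a L)| ≤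
      avgBonus H b (nexts h s a L).length := by
  rcases Nat.eq_zero_or_pos (nexts h s a L).length with h0 | hpos
  · simp [List.length_eq_zero_iff.1 h0, recAverage, avgBonus]
  · simpa using (hL h s a _ hpos le_rfl).trans (le_avgBonus hb hpos)

end Noise

section Optimism

variable {S A : Type*} {H : ℕ} [Fintype A] [Nonempty A]

/-- The truncated greedy value at step `n`, which is `0` for `n ≥ H`. -/
def Tables.valueAt (T : Tables S A H) (n : ℕ) (s : S) : ℝ :=
  if hn : n < H then T.value ⟨n, hn⟩ s else 0

theorem Tables.valueAt_nonneg {T : Tables S A H} (hT : ∀ h s a, 0 ≤ T.Q h s a) (n : ℕ) (s : S) :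
    0 ≤ T.valueAt n s := by
  unfold Tables.valueAt
  split_ifs with hn
  · obtain ⟨a⟩ := ‹Nonempty A›
    exact le_min (Nat.cast_nonneg _) ((hT _ s a).trans (Finset.le_sup' _ (Finset.mem_univ a)))
  · exact le_rfl

theorem Tables.valueAt_le (T : Tables S A H) (n : ℕ) (s : S) : T.valueAt n s ≤ H := by
  unfold Tables.valueAt
  split_ifs with hn
  · exact min_le_left _ _
  · exact Nat.cast_nonneg _

theorem Tables.update_Q_self (b : ℕ → ℝ) (r : Fin H → S → A → S → ℝ) (T : Tables S A H)
    (h : Fin H) (s : S) (a : A) (s' : S) :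
    (T.update b r ⟨h, s, a, s'⟩).Q h s a =
      (1 - learningRate H (T.count h s a + 1)) * T.Q h s a + learningRate H (T.count h s a + 1) *
        (r h s a s' + T.valueAt (h + 1) s' + b (T.count h s a + 1)) := by
  simp [Tables.update, Tables.nextValue, Tables.valueAt]

theorem Tables.update_Q_of_ne (b : ℕ → ℝ) (r : Fin H → S → A → S → ℝ) (T : Tables S A H)
    {x : Transition S A H} {h : Fin H} {s : S} {a : A}
    (hx : ¬(h = x.step ∧ s = x.state ∧ a = x.action)) :
    (T.update b r x).Q h s a = T.Q h s a := by
  simp only [Tables.update, if_neg hx]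

theorem Tables.update_count_self (b : ℕ → ℝ) (r : Fin H → S → A → S → ℝ) (T : Tables S A H)
    (h : Fin H) (s : S) (a : A) (s' : S) :
    (T.update b r ⟨h, s, a, s'⟩).count h s a = T.count h s a + 1 := by
  simp [Tables.update]

theorem Tables.update_count_of_ne (b : ℕ → ℝ) (r : Fin H → S → A → S → ℝ) (T : Tables S A H)
    {x : Transition S A H} {h : Fin H} {s : S} {a : A}
    (hx : ¬(h = x.step ∧ s = x.state ∧ a = x.action)) :
    (T.update b r x).count h s a = T.count h s a := by
  simp only [Tables.update, if_neg hx]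

theorem Tables.valueAt_update_of_ne (b : ℕ → ℝ) (r : Fin H → S → A → S → ℝ) (T : Tables S A H)
    {x : Transition S A H} {n : ℕ} (hn : n ≠ x.step) (s : S) :
    (T.update b r x).valueAt n s = T.valueAt n s := by
  have hQ : ∀ h : n < H, (T.update b r x).Q ⟨n, h⟩ s = T.Q ⟨n, h⟩ s := fun h =>
    funext fun a => T.update_Q_of_ne b r fun hx => hn (congrArg Fin.val hx.1)
  simp only [Tables.valueAt, Tables.value, hQ]

theorem learn_concat (b : ℕ → ℝ) (r : Fin H → S → A → S → ℝ) (L : List (Transition S A H))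
    (x : Transition S A H) : learn b r (L ++ [x]) = (learn b r L).update b r x := by
  simp [learn]

theorem learn_count (b : ℕ → ℝ) (r : Fin H → S → A → S → ℝ) (L : List (Transition S A H))
    (h : Fin H) (s : S) (a : A) : (learn b r L).count h s a = (nexts h s a L).length := by
  induction L using List.reverseRecOn with
  | nil => rfl
  | append_singleton L x ih =>
    rw [learn_concat, nexts_concat]
    simp only [Tables.update]
    split_ifs <;> simp [ih]

theorem pseudoTables_concat (b : ℕ → ℝ) (L : List (Transition S A H)) (x : Transition S A H) :
    pseudoTables b (L ++ [x]) =
      (pseudoTables b L).update (fun t => 2 * b t) (fun _ _ _ _ => 0) x :=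
  learn_concat _ _ L x

theorem pseudoTables_count (b : ℕ → ℝ) (L : List (Transition S A H)) (h : Fin H) (s : S) (a : A) :
    (pseudoTables b L).count h s a = (nexts h s a L).length :=
  learn_count _ _ L h s a

theorem learn_nonneg {b : ℕ → ℝ} (hb : ∀ t, 0 ≤ b t) {r : Fin H → S → A → S → ℝ}
    (hr : ∀ h s a s', 0 ≤ r h s a s') (L : List (Transition S A H)) (h : Fin H) (s : S) (a : A) :
    0 ≤ (learn b r L).Q h s a := by
  induction L using List.reverseRecOn generalizing h s a with
  | nil => simp [learn, Tables.init]
  | append_singleton L x ih =>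
    obtain ⟨g, y, c, s'⟩ := x
    rw [learn_concat]
    by_cases hx : h = g ∧ s = y ∧ a = c
    · obtain ⟨rfl, rfl, rfl⟩ := hx
      rw [Tables.update_Q_self]
      exact add_nonneg (mul_nonneg (sub_nonneg.2 learningRate_succ_le_one) (ih h s a))
        (mul_nonneg learningRate_nonneg (add_nonneg (add_nonneg (hr h s a s')
          (Tables.valueAt_nonneg ih _ _)) (hb _)))
    · rw [Tables.update_Q_of_ne b r _ hx]
      exact ih h s a

variable [Fintype S] {M : EpisodicMDP S A H} {r : Fin H → S → A → S → ℝ} {V : ℕ → S → ℝ}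
  {b : ℕ → ℝ} {L : List (Transition S A H)}

/-- `V` is the optimal value function for the reward function `r` (it satisfies the Bellman
optimality equations and vanishes after the last step), and all rewards-to-go lie in `[0, 1]`. -/
structure IsOptimalValue (M : EpisodicMDP S A H) (r : Fin H → S → A → S → ℝ)
    (V : ℕ → S → ℝ) : Prop where
  value_eq (h : Fin H) (s : S) :
    V h s = Finset.univ.sup' Finset.univ_nonempty (actionValue M r V h s)
  last (s : S) : V H s = 0
  mem_Icc (h : Fin H) (s : S) (a : A) (s' : S) : r h s a s' + V (h + 1) s' ∈ Set.Icc (0 : ℝ) 1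

namespace IsOptimalValue

theorem actionValue_mem_Icc (hV : IsOptimalValue M r V) (h : Fin H) (s : S) (a : A) :
    actionValue M r V h s a ∈ Set.Icc (0 : ℝ) 1 := by
  constructor
  · exact Finset.sum_nonneg fun x _ => mul_nonneg ENNReal.toReal_nonneg (hV.mem_Icc h s a x).1
  · rw [← sum_toReal_apply (M.P h s a)]
    exact Finset.sum_le_sum fun x _ =>
      mul_le_of_le_one_right ENNReal.toReal_nonneg (hV.mem_Icc h s a x).2

theorem abs_noise_le (hV : IsOptimalValue M r V) (h : Fin H) (s : S) (a : A) (s' : S) :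
    |noise M r V h s a s'| ≤ 1 := by
  have hQ := hV.actionValue_mem_Icc h s a
  have hr := hV.mem_Icc h s a s'
  rw [abs_le, noise]
  constructor <;> linarith [hQ.1, hQ.2, hr.1, hr.2]

theorem le_valueAt (hV : IsOptimalValue M r V) {T : Tables S A H}
    (hT : ∀ h s a, actionValue M r V h s a ≤ T.Q h s a) {n : ℕ} (hn : n ≤ H) (s : S) :
    V n s ≤ T.valueAt n s := by
  rcases hn.lt_or_eq with hn | rfl
  · have hH : (1 : ℝ) ≤ H := by exact_mod_cast (by omega : 1 ≤ H)
    rw [Tables.valueAt, dif_pos hn, hV.value_eq ⟨n, hn⟩ s]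
    refine le_min (Finset.sup'_le _ _ fun a _ => (hV.actionValue_mem_Icc _ s a).2.trans hH) ?_
    exact Finset.sup'_mono_fun fun a _ => hT _ s a
  · simp [Tables.valueAt, hV.last]

theorem valueAt_le (hV : IsOptimalValue M r V) {T U : Tables S A H}
    (hT : ∀ h s a, T.Q h s a ≤ actionValue M r V h s a + U.Q h s a) {n : ℕ} (hn : n ≤ H) (s : S) :
    T.valueAt n s ≤ V n s + U.valueAt n s := by
  rcases hn.lt_or_eq with hn | rfl
  · have hmax : ∀ a, actionValue M r V ⟨n, hn⟩ s a ≤ V n s := fun a => by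
      rw [hV.value_eq ⟨n, hn⟩ s]
      exact Finset.le_sup' _ (Finset.mem_univ a)
    have hV0 : 0 ≤ V n s := by
      obtain ⟨a⟩ := ‹Nonempty A›
      exact (hV.actionValue_mem_Icc _ s a).1.trans (hmax a)
    simp only [Tables.valueAt, dif_pos hn, Tables.value]
    rw [← min_add_add_left]
    refine le_min ((min_le_left _ _).trans (by linarith)) ((min_le_right _ _).trans ?_)
    exact Finset.sup'_le _ _ fun a _ => (hT _ s a).trans
      (add_le_add (hmax a) (Finset.le_sup' (U.Q ⟨n, hn⟩ s) (Finset.mem_univ a)))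
  · simp [Tables.valueAt, hV.last]

theorem recAverage_add_avgBonus_le (hV : IsOptimalValue M r V) (hb : AntitoneOn b (Set.Ici 1))
    (hL : IsNoiseBounded M r V b L) (h : Fin H) (s : S) (a : A) :
    recAverage H (noise M r V h s a) (nexts h s a L) + avgBonus H b (nexts h s a L).length ≤
      (learn b r L).Q h s a - actionValue M r V h s a := by
  induction L using List.reverseRecOn generalizing h s a with
  | nil =>
    have hQ := (hV.actionValue_mem_Icc h s a).2
    have hH : (1 : ℝ) ≤ H := by exact_mod_cast h.pos
    simp only [nexts, recAverage, List.filter_nil, List.map_nil, weightedSum_nil, List.length_nil,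
      avgBonus, learn, List.foldl_nil, Tables.init]
    linarith
  | append_singleton L x ih =>
    replace ih := ih hL.of_append
    obtain ⟨g, y, c, s'⟩ := x
    by_cases hx : h = g ∧ s = y ∧ a = c
    · obtain ⟨rfl, rfl, rfl⟩ := hx
      have hlow : V (h + 1) s' ≤ (learn b r L).valueAt (h + 1) s' :=
        hV.le_valueAt (fun h s a => by
          linarith [ih h s a, (abs_le.1 (hL.of_append.abs_recAverage_le hb h s a)).1]) h.isLt s'
      rw [nexts_concat, if_pos ⟨rfl, rfl, rfl⟩, learn_concat, Tables.update_Q_self, learn_count,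
        recAverage_concat, List.length_append, List.length_singleton, avgBonus, noise]
      set α := learningRate H ((nexts h s a L).length + 1)
      have hα : α ≤ 1 := learningRate_succ_le_one
      linarith [mul_le_mul_of_nonneg_left (ih h s a) (sub_nonneg.2 hα),
        mul_le_mul_of_nonneg_left hlow (learningRate_nonneg : 0 ≤ α)]
    · rw [nexts_concat, if_neg hx, learn_concat, Tables.update_Q_of_ne b r _ hx]
      exact ih h s a

theorem actionValue_le_learn (hV : IsOptimalValue M r V) (hb : AntitoneOn b (Set.Ici 1))
    (hL : IsNoiseBounded M r V b L) (h : Fin H) (s : S) (a : A) :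
    actionValue M r V h s a ≤ (learn b r L).Q h s a := by
  linarith [hV.recAverage_add_avgBonus_le hb hL h s a,
    (abs_le.1 (hL.abs_recAverage_le hb h s a)).1]

/-- Subtracting the noise and adding the averaged bonus on the left-hand side turns the comparison
into an invariant of the updates: the pseudo-values are learned with twice the bonus. -/
theorem learn_sub_le_pseudoTables (hV : IsOptimalValue M r V) (hb : AntitoneOn b (Set.Ici 1))
    (hL : IsNoiseBounded M r V b L) (h : Fin H) (s : S) (a : A) :
    (learn b r L).Q h s a - actionValue M r V h s a
        - recAverage H (noise M r V h s a) (nexts h s a L) + avgBonus H b (nexts h s a L).length ≤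
      (pseudoTables b L).Q h s a := by
  induction L using List.reverseRecOn generalizing h s a with
  | nil =>
    have hQ := (hV.actionValue_mem_Icc h s a).1
    simp only [nexts, recAverage, List.filter_nil, List.map_nil, weightedSum_nil, List.length_nil,
      avgBonus, learn, pseudoTables, List.foldl_nil, Tables.init]
    linarith
  | append_singleton L x ih =>
    replace ih := ih hL.of_append
    obtain ⟨g, y, c, s'⟩ := x
    by_cases hx : h = g ∧ s = y ∧ a = c
    · obtain ⟨rfl, rfl, rfl⟩ := hx
      have hup : (learn b r L).valueAt (h + 1) s' ≤
          V (h + 1) s' + (pseudoTables b L).valueAt (h + 1) s' :=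
        hV.valueAt_le (fun h s a => by
          linarith [ih h s a, (abs_le.1 (hL.of_append.abs_recAverage_le hb h s a)).2]) h.isLt s'
      rw [nexts_concat, if_pos ⟨rfl, rfl, rfl⟩, learn_concat, pseudoTables_concat,
        Tables.update_Q_self, Tables.update_Q_self, learn_count, pseudoTables_count,
        recAverage_concat, List.length_append, List.length_singleton, avgBonus, noise]
      set α := learningRate H ((nexts h s a L).length + 1)
      have hα : α ≤ 1 := learningRate_succ_le_one
      linarith [mul_le_mul_of_nonneg_left (ih h s a) (sub_nonneg.2 hα),
        mul_le_mul_of_nonneg_left hup (learningRate_nonneg : 0 ≤ α)]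
    · rw [nexts_concat, if_neg hx, learn_concat, pseudoTables_concat,
        Tables.update_Q_of_ne _ _ _ hx, Tables.update_Q_of_ne _ _ _ hx]
      exact ih h s a

theorem le_valueAt_learn (hV : IsOptimalValue M r V) (hb : AntitoneOn b (Set.Ici 1))
    (hL : IsNoiseBounded M r V b L) {n : ℕ} (hn : n ≤ H) (s : S) :
    V n s ≤ (learn b r L).valueAt n s :=
  hV.le_valueAt (hV.actionValue_le_learn hb hL) hn s

theorem valueAt_learn_le (hV : IsOptimalValue M r V) (hb : AntitoneOn b (Set.Ici 1))
    (hL : IsNoiseBounded M r V b L) {n : ℕ} (hn : n ≤ H) (s : S) :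
    (learn b r L).valueAt n s ≤ V n s + (pseudoTables b L).valueAt n s := by
  refine hV.valueAt_le (fun h s a => ?_) hn s
  linarith [hV.learn_sub_le_pseudoTables hb hL h s a,
    (abs_le.1 (hL.abs_recAverage_le hb h s a)).2]

end IsOptimalValue

theorem IsOptimalValue.toOuterMeasure_not_isNoiseBounded_le (hV : IsOptimalValue M r V)
    (act : ActionRule S A H) (K : ℕ) {β : ℝ} (hβ : 0 ≤ β) :
    (explore M act K).toOuterMeasure {D | ¬IsNoiseBounded M r V (sqrtBonus β) D.flatten} ≤
      Fintype.card ((Fin H × S × A) × Fin (K * H)) *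
        (2 * ENNReal.ofReal (Real.exp (-(β ^ 2 / (4 * H))))) := by
  let E (i : (Fin H × S × A) × Fin (K * H)) (D : List (List (Transition S A H))) : Prop :=
    sqrtBonus β (i.2 + 1) ≤ |weightedSum (weight H (i.2 + 1)) (noise M r V i.1.1 i.1.2.1 i.1.2.2)
      (nexts i.1.1 i.1.2.1 i.1.2.2 D.flatten)|
  have hsub : {D | ¬IsNoiseBounded M r V (sqrtBonus β) D.flatten} ∩ (explore M act K).support ⊆
      {D | ∃ i, E i D} := by
    rintro D ⟨hD, hsupp⟩
    simp only [IsNoiseBounded, Set.mem_ofPred_eq, not_forall, not_le] at hD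
    obtain ⟨h, s, a, t, ht, htD, hlt⟩ := hD
    have htK : t - 1 < K * H := by
      have := length_nexts_le h s a D.flatten
      rw [length_flatten_of_mem_support_explore hsupp] at this
      omega
    rw [← weightedSum_weight_eq_recAverage_take _ htD] at hlt
    exact ⟨⟨(h, s, a), t - 1, htK⟩, by simpa [E, Nat.sub_add_cancel ht] using hlt.le⟩
  refine (PMF.toOuterMeasure_mono _ hsub).trans (toOuterMeasure_exists_le _ ?_)
  rintro ⟨⟨h, s, a⟩, i⟩
  have hH : (0 : ℝ) < H := by exact_mod_cast h.pos
  have hexp : sqrtBonus β (i + 1) ^ 2 / (2 * (2 * H / (i + 1 : ℕ))) = β ^ 2 / (4 * H) := by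
    rw [sqrtBonus, div_pow, Real.sq_sqrt (Nat.cast_nonneg _)]
    field_simp
    norm_num
  rw [← hexp]
  exact toOuterMeasure_abs_weightedSum_ge_le act K (hV.abs_noise_le h s a) (sum_noise M r V h s a)
    (sum_weight_sq_le h.pos _) (by positivity) (sqrtBonus_nonneg hβ _)

end Optimism

section Potential

/-! ### The pseudo-values along the exploration -/

variable {S A : Type*} {H : ℕ}

/-- The factor `1 + 1/H` by which value differences grow from one step to the previous one. -/
def growth (H : ℕ) : ℝ := 1 + 1 / H

theorem one_le_growth (H : ℕ) : 1 ≤ growth H :=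
  le_add_of_nonneg_right (by positivity)

theorem growth_pow_le {n : ℕ} (hn : n ≤ H) : growth H ^ n ≤ 3 := by
  calc growth H ^ n ≤ growth H ^ H := pow_le_pow_right₀ (one_le_growth H) hn
    _ ≤ Real.exp 1 := by simpa only [growth, one_div] using Real.one_add_inv_pow_le_exp
    _ ≤ 3 := Real.exp_one_lt_three.le

theorem one_div_sqrt_succ_le (t : ℕ) : 1 / √(t + 1 : ℕ) ≤ 2 * (√(t + 1 : ℕ) - √t) := by
  rw [div_le_iff₀ (Real.sqrt_pos.2 (by positivity))]
  have hsucc := Real.sq_sqrt (Nat.cast_nonneg (α := ℝ) (t + 1))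
  have ht := Real.sq_sqrt (Nat.cast_nonneg (α := ℝ) t)
  push_cast at hsucc ⊢
  nlinarith [sq_nonneg (√((t : ℝ) + 1) - √t)]

theorem sum_sqrt_le_sqrt_card_mul_sum {ι : Type*} [Fintype ι] {f : ι → ℝ} (hf : ∀ i, 0 ≤ f i) :
    ∑ i, √(f i) ≤ √(Fintype.card ι * ∑ i, f i) := by
  refine Real.le_sqrt_of_sq_le (sq_sum_le_card_mul_sum_sq.trans_eq ?_)
  simp [fun i => Real.sq_sqrt (hf i)]

/-- The contribution to `potential` of an entry at step `h` that has been visited `t` times and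
has the value `q`. The factor `1 + t / H` makes the decrease of an entry at an update exactly its
value minus `growth H` times the next value, and `4 β √t` pays for the bonuses `2 β / √t`. -/
def entryPotential (H : ℕ) (β : ℝ) (h t : ℕ) (q : ℝ) : ℝ :=
  growth H ^ h * ((1 + t / H) * q - growth H * (4 * β * √t))

theorem entryPotential_succ_le {β : ℝ} (hβ : 0 ≤ β) (hH : 0 < H) (h t : ℕ) (q v : ℝ) :
    entryPotential H β h (t + 1) ((1 - learningRate H (t + 1)) * q
        + learningRate H (t + 1) * (v + 2 * sqrtBonus β (t + 1))) ≤
      entryPotential H β h t q - growth H ^ h * q + growth H ^ (h + 1) * v := by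
  have : (0 : ℝ) < H := by exact_mod_cast hH
  have hg : 0 ≤ growth H := zero_le_one.trans (one_le_growth H)
  have hold : (1 + (t + 1 : ℕ) / (H : ℝ)) * (1 - learningRate H (t + 1)) = t / H := by
    rw [one_sub_learningRate]
    push_cast
    field_simp
    ring
  have hnew : (1 + (t + 1 : ℕ) / (H : ℝ)) * learningRate H (t + 1) = growth H := by
    rw [learningRate, growth]
    push_cast
    have : (H : ℝ) + (t + 1) ≠ 0 := by positivity
    field_simp
  have hbonus : sqrtBonus β (t + 1) ≤ β * (2 * (√(t + 1 : ℕ) - √t)) := by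
    rw [sqrtBonus, div_eq_mul_one_div]
    exact mul_le_mul_of_nonneg_left (one_div_sqrt_succ_le t) hβ
  have hpaid := mul_le_mul_of_nonneg_left hbonus (mul_nonneg (pow_nonneg hg h) hg)
  unfold entryPotential
  linear_combination 2 * hpaid + growth H ^ h * q * hold
    + growth H ^ h * (v + 2 * sqrtBonus β (t + 1)) * hnew

variable [Fintype S] [Fintype A]

theorem sum_length_nexts (L : List (Transition S A H)) :
    ∑ i : Fin H × S × A, (nexts i.1 i.2.1 i.2.2 L).length = L.length := by
  classical
  induction L using List.reverseRecOn with
  | nil => simp [nexts]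
  | append_singleton L x ih =>
    have hterm : ∀ i : Fin H × S × A, (nexts i.1 i.2.1 i.2.2 (L ++ [x])).length =
        (nexts i.1 i.2.1 i.2.2 L).length + if i = (x.step, x.state, x.action) then 1 else 0 :=
      fun i => by
        simp only [nexts_concat, Prod.ext_iff]
        split_ifs <;> simp
    simp [hterm, Finset.sum_add_distrib, ih]

/-- The sum of `entryPotential` over all entries of the tables; along greedy exploration its
decrease in an episode bounds the pseudo-value at the start of the episode. -/
def potential (β : ℝ) (T : Tables S A H) : ℝ :=
  ∑ i : Fin H × S × A, entryPotential H β i.1 (T.count i.1 i.2.1 i.2.2) (T.Q i.1 i.2.1 i.2.2)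

theorem potential_init_le (β : ℝ) :
    potential β (Tables.init S A H) ≤ 3 * (Fintype.card S * Fintype.card A * (H : ℝ) ^ 2) := by
  calc potential β (Tables.init S A H)
      = ∑ i : Fin H × S × A, growth H ^ (i.1 : ℕ) * H := by
        simp [potential, Tables.init, entryPotential]
    _ ≤ ∑ _i : Fin H × S × A, (3 : ℝ) * H :=
        Finset.sum_le_sum fun i _ =>
          mul_le_mul_of_nonneg_right (growth_pow_le i.1.isLt.le) (Nat.cast_nonneg _)
    _ = 3 * (Fintype.card S * Fintype.card A * (H : ℝ) ^ 2) := by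
        simp
        ring

theorem neg_potential_le {β : ℝ} (hβ : 0 ≤ β) {T : Tables S A H} (hT : ∀ h s a, 0 ≤ T.Q h s a) :
    -potential β T ≤ 12 * β * √(Fintype.card (Fin H × S × A) *
      ∑ i : Fin H × S × A, (T.count i.1 i.2.1 i.2.2 : ℝ)) := by
  have hg : 0 ≤ growth H := zero_le_one.trans (one_le_growth H)
  calc -potential β T
      ≤ ∑ i : Fin H × S × A, 12 * β * √(T.count i.1 i.2.1 i.2.2) := by
        rw [potential, ← Finset.sum_neg_distrib]
        refine Finset.sum_le_sum fun ⟨h, s, a⟩ _ => ?_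
        have hpow : growth H ^ ((h : ℕ) + 1) ≤ 3 := growth_pow_le h.isLt
        have hbonus := mul_le_mul_of_nonneg_right hpow
          (by positivity : 0 ≤ 4 * β * √(T.count h s a))
        have hQ : 0 ≤ growth H ^ (h : ℕ) * ((1 + (T.count h s a : ℝ) / H) * T.Q h s a) := by
          have := hT h s a
          positivity
        simp only [entryPotential]
        linear_combination hbonus + hQ
    _ = 12 * β * ∑ i : Fin H × S × A, √(T.count i.1 i.2.1 i.2.2) := by rw [Finset.mul_sum]
    _ ≤ _ := by
        gcongr
        exact sum_sqrt_le_sqrt_card_mul_sum fun i => Nat.cast_nonneg _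

variable [Nonempty A]

theorem potential_update_le {β : ℝ} (hβ : 0 ≤ β) (T : Tables S A H) {x : Transition S A H}
    (hx : ∀ a, T.Q x.step x.state a ≤ T.Q x.step x.state x.action) :
    potential β (T.update (fun t => 2 * sqrtBonus β t) (fun _ _ _ _ => 0) x)
        - growth H ^ (x.step + 1 : ℕ) * T.valueAt (x.step + 1) x.next ≤
      potential β T - growth H ^ (x.step : ℕ) * T.valueAt x.step x.state := by
  obtain ⟨h, s, a, s'⟩ := x
  set T' := T.update (fun t => 2 * sqrtBonus β t) (fun _ _ _ _ => 0) ⟨h, s, a, s'⟩ with hT'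
  have hvalue : T.valueAt h s ≤ T.Q h s a := by
    rw [Tables.valueAt, dif_pos h.isLt]
    exact (min_le_right _ _).trans (Finset.sup'_le _ _ fun a' _ => hx a')
  have hgreedy : growth H ^ (h : ℕ) * T.valueAt h s ≤ growth H ^ (h : ℕ) * T.Q h s a :=
    mul_le_mul_of_nonneg_left hvalue (pow_nonneg (zero_le_one.trans (one_le_growth H)) _)
  have hdiff : potential β T' - potential β T =
      entryPotential H β h (T'.count h s a) (T'.Q h s a)
        - entryPotential H β h (T.count h s a) (T.Q h s a) := by
    unfold potential
    rw [← Finset.sum_sub_distrib]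
    refine Finset.sum_eq_single (h, s, a) (fun i _ hi => ?_) (by simp)
    have hne : ¬(i.1 = h ∧ i.2.1 = s ∧ i.2.2 = a) := fun hi' =>
      hi (Prod.ext hi'.1 (Prod.ext hi'.2.1 hi'.2.2))
    rw [hT', Tables.update_Q_of_ne _ _ _ hne, Tables.update_count_of_ne _ _ _ hne, sub_self]
  rw [hT', Tables.update_Q_self, Tables.update_count_self, zero_add] at hdiff
  linarith [entryPotential_succ_le hβ h.pos h (T.count h s a) (T.Q h s a)
    (T.valueAt (h + 1) s')]

variable {M : EpisodicMDP S A H} {β : ℝ} {act : ActionRule S A H}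

theorem rollout_potential_le (hβ : 0 ≤ β) (hact : IsGreedy (sqrtBonus β) act)
    (L : List (Transition S A H)) {n : ℕ} (hn : n ≤ H) {es : List (Transition S A H) × S}
    (hes : es ∈ (rollout M act L n).support) :
    potential β (pseudoTables (sqrtBonus β) (L ++ es.1))
        - growth H ^ n * (pseudoTables (sqrtBonus β) (L ++ es.1)).valueAt n es.2 ≤
      potential β (pseudoTables (sqrtBonus β) L)
        - (pseudoTables (sqrtBonus β) L).valueAt 0 M.start := by
  induction n generalizing es with
  | zero =>
    obtain rfl : es = ([], M.start) := by simpa [rollout] using hes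
    simp
  | succ n ih =>
    obtain ⟨es₀, h₀, a, ha, s', -, rfl⟩ := (mem_support_rollout_succ hn).1 hes
    refine le_trans ?_ (ih (by omega) h₀)
    rw [← List.append_assoc, pseudoTables_concat, Tables.valueAt_update_of_ne _ _ _ (by simp)]
    exact potential_update_le hβ _ (hact _ _ _ a ha)

theorem explore_potential_le (hβ : 0 ≤ β) (hact : IsGreedy (sqrtBonus β) act) {K : ℕ}
    {D : List (List (Transition S A H))} (hD : D ∈ (explore M act K).support) :
    ∑ k ∈ Finset.range K, (pseudoTables (sqrtBonus β) (D.take k).flatten).valueAt 0 M.start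
        + potential β (pseudoTables (sqrtBonus β) D.flatten) ≤
      potential β (Tables.init S A H) := by
  induction K generalizing D with
  | zero =>
    obtain rfl : D = [] := by simpa [explore] using hD
    simp [pseudoTables, learn]
  | succ K ih =>
    obtain ⟨D, h₀, es, hes, rfl⟩ := mem_support_explore_succ.1 hD
    have hlen : D.length = K := length_of_mem_support_explore h₀
    have hepisode := rollout_potential_le hβ hact D.flatten le_rfl hes
    rw [Tables.valueAt, dif_neg (lt_irrefl H), mul_zero, sub_zero] at hepisode
    have htake : ∀ k ∈ Finset.range (K + 1), (D ++ [es.1]).take k = D.take k := fun k hk =>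
      List.take_append_of_le_length (by have := Finset.mem_range.1 hk; omega)
    rw [Finset.sum_congr rfl fun k hk => by rw [htake k hk], Finset.sum_range_succ,
      List.take_of_length_le hlen.le, List.flatten_append, List.flatten_singleton]
    linarith [ih h₀]

theorem sum_valueAt_pseudoTables_le (hβ : 0 ≤ β) (hact : IsGreedy (sqrtBonus β) act) {K : ℕ}
    {D : List (List (Transition S A H))} (hD : D ∈ (explore M act K).support) :
    ∑ k ∈ Finset.range K, (pseudoTables (sqrtBonus β) (D.take k).flatten).valueAt 0 M.start ≤
      3 * (Fintype.card S * Fintype.card A * (H : ℝ) ^ 2)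
        + 12 * β * (H * √(Fintype.card S * Fintype.card A * K)) := by
  have hfinal := neg_potential_le hβ (T := pseudoTables (sqrtBonus β) D.flatten)
    (learn_nonneg (fun t => mul_nonneg zero_le_two (sqrtBonus_nonneg hβ t))
      (fun _ _ _ _ => le_rfl) _)
  have hcount : ∑ i : Fin H × S × A,
      ((pseudoTables (sqrtBonus β) D.flatten).count i.1 i.2.1 i.2.2 : ℝ) = K * H := by
    simp_rw [pseudoTables_count]
    exact_mod_cast (sum_length_nexts D.flatten).trans (length_flatten_of_mem_support_explore hD)
  have hsqrt : √(Fintype.card (Fin H × S × A) * (K * H)) =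
      H * √(Fintype.card S * Fintype.card A * K) := by
    rw [← Real.sqrt_sq (Nat.cast_nonneg (α := ℝ) H), ← Real.sqrt_mul (sq_nonneg _),
      Real.sqrt_sq (Nat.cast_nonneg _)]
    congr 1
    simp only [Fintype.card_prod, Fintype.card_fin]
    push_cast
    ring
  rw [hcount, hsqrt] at hfinal
  linarith [explore_potential_le hβ hact hD, potential_init_le (S := S) (A := A) (H := H) β]

end Potential

section Reachability

/-! ### Optimal values of the indicator rewards -/

variable {S A : Type*} {H : ℕ}

open Classical in
/-- The maximal probability of being in `s` at step `h`, when the state at step `n` is `x`;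
it is `0` for `n > h`. -/
def maxReach (M : EpisodicMDP S A H) (h : Fin H) (s : S) (n : ℕ) (x : S) : ℝ≥0∞ :=
  if hn : n < h then ⨆ a, expect (M.P ⟨n, hn.trans h.isLt⟩ x a) (maxReach M h s (n + 1))
  else if n = h ∧ x = s then 1 else 0
termination_by h - n

variable (M : EpisodicMDP S A H) {g h : Fin H} (s : S)

theorem maxReach_of_lt (hg : g < h) (x : S) :
    maxReach M h s g x = ⨆ a, expect (M.P g x a) (maxReach M h s (g + 1)) := by
  rw [maxReach, dif_pos (by exact hg)]

open Classical in
theorem maxReach_self (h : Fin H) (x : S) : maxReach M h s h x = if x = s then 1 else 0 := by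
  rw [maxReach]
  simp

theorem maxReach_of_gt {n : ℕ} (hn : h < n) (x : S) : maxReach M h s n x = 0 := by
  rw [maxReach, dif_neg hn.not_gt, if_neg fun hx => hn.ne' hx.1]

theorem maxReach_le_one (h : Fin H) (n : ℕ) (x : S) : maxReach M h s n x ≤ 1 := by
  fun_induction maxReach M h s n x with
  | case1 n x hn ih => exact iSup_le fun a => expect_le _ ih
  | case2 => rfl
  | case3 => exact zero_le

theorem maxReach_ne_top (h : Fin H) (n : ℕ) (x : S) : maxReach M h s n x ≠ ∞ :=
  ((maxReach_le_one M s h n x).trans_lt ENNReal.one_lt_top).ne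

theorem expect_maxReach_self (h : Fin H) (q : PMF S) : expect q (maxReach M h s h) = q s := by
  classical
  simp [expect, maxReach_self, tsum_ite_eq]

theorem expect_stateLaw_succ (π : Policy S A H) (g : Fin H) (f : S → ℝ≥0∞) :
    expect (stateLaw M π (g + 1)) f =
      expect (stateLaw M π g) fun x => expect (π g x) fun a => expect (M.P g x a) f := by
  simp only [stateLaw, dif_pos g.isLt, expect_bind]

theorem stateLaw_le_expect_maxReach (π : Policy S A H) {n : ℕ} (hn : n ≤ h) :
    stateLaw M π h s ≤ expect (stateLaw M π n) (maxReach M h s n) := by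
  induction hn using Nat.decreasingInduction with
  | self => rw [expect_maxReach_self]
  | of_succ n hn ih =>
    let g : Fin H := ⟨n, hn.trans h.isLt⟩
    refine ih.trans ?_
    rw [expect_stateLaw_succ M π g]
    refine expect_mono _ fun x => expect_le _ fun a => ?_
    rw [maxReach_of_lt M s (g := g) hn]
    exact le_iSup (fun a => expect (M.P g x a) _) a

theorem exists_stateLaw_eq_maxReach [Finite A] [Nonempty A] (h : Fin H) :
    ∃ π : Policy S A H, stateLaw M π h s = maxReach M h s 0 M.start := by
  have hmax : ∀ (g : Fin H) (x : S), ∃ a, expect (M.P g x a) (maxReach M h s (g + 1)) =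
      ⨆ a, expect (M.P g x a) (maxReach M h s (g + 1)) := fun g x => exists_eq_ciSup_of_finite
  choose act hact using hmax
  refine ⟨fun g x => PMF.pure (act g x), ?_⟩
  have hinv : ∀ n ≤ (h : ℕ), expect (stateLaw M (fun g x => PMF.pure (act g x)) n)
      (maxReach M h s n) = maxReach M h s 0 M.start := by
    intro n hn
    induction n with
    | zero => rw [stateLaw, expect_pure]
    | succ n ih =>
      let g : Fin H := ⟨n, by omega⟩
      rw [← ih (by omega), expect_stateLaw_succ M _ g]
      congr 1
      funext x
      rw [expect_pure, hact g, ← maxReach_of_lt M s (g := g) hn]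
  rw [← hinv h le_rfl, expect_maxReach_self]

theorem reachability_eq_maxReach [Finite A] [Nonempty A] (h : Fin H) :
    reachability M h s = (maxReach M h s 0 M.start).toReal := by
  rw [reachability]
  congr 1
  apply le_antisymm
  · refine iSup_le fun π => (stateLaw_le_expect_maxReach M s π (Nat.zero_le _)).trans ?_
    rw [stateLaw, expect_pure]
  · obtain ⟨π, hπ⟩ := exists_stateLaw_eq_maxReach M s h
    exact hπ ▸ le_iSup (fun π => stateLaw M π h s) π

/-- The value function `κ` times `maxReach`: the optimal one for a reward that is only paid at
step `h`, if the largest mean reward there is `κ` in state `s` and `0` in the other states. -/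
def scaledReach (h : Fin H) (κ : ℝ) (n : ℕ) (x : S) : ℝ :=
  κ * (maxReach M h s n x).toReal

variable {κ : ℝ}

theorem scaledReach_mem_Icc (hκ : κ ∈ Set.Icc (0 : ℝ) 1) (h : Fin H) (n : ℕ) (x : S) :
    scaledReach M s h κ n x ∈ Set.Icc (0 : ℝ) 1 :=
  ⟨mul_nonneg hκ.1 ENNReal.toReal_nonneg, mul_le_one₀ hκ.2 ENNReal.toReal_nonneg
    (ENNReal.toReal_le_of_le_ofReal zero_le_one (by simpa using maxReach_le_one M s h n x))⟩

theorem scaledReach_start [Finite A] [Nonempty A] (h : Fin H) (κ : ℝ) :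
    scaledReach M s h κ 0 M.start = κ * reachability M h s := by
  rw [scaledReach, reachability_eq_maxReach]

theorem scaledReach_of_gt {n : ℕ} (hn : h < n) (κ : ℝ) (x : S) : scaledReach M s h κ n x = 0 := by
  rw [scaledReach, maxReach_of_gt M s hn, ENNReal.toReal_zero, mul_zero]

variable [Fintype S] {r : Fin H → S → A → S → ℝ}

theorem actionValue_scaledReach_of_ne (hr : r g = 0) (h : Fin H) (κ : ℝ) (x : S) (a : A) :
    actionValue M r (scaledReach M s h κ) g x a =
      κ * (expect (M.P g x a) (maxReach M h s (g + 1))).toReal := by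
  rw [toReal_expect _ (maxReach_ne_top M s h _), Finset.mul_sum]
  refine Finset.sum_congr rfl fun x' _ => ?_
  simp only [hr, Pi.zero_apply, scaledReach, zero_add]
  ring

theorem actionValue_scaledReach_self (h : Fin H) (κ : ℝ) (x : S) (a : A) :
    actionValue M r (scaledReach M s h κ) h x a =
      ∑ x', (M.P h x a x').toReal * r h x a x' := by
  simp only [actionValue, scaledReach_of_gt M s (Nat.lt_succ_self h), add_zero]

variable [Fintype A] [Nonempty A]

open Classical in
theorem isOptimalValue_scaledReach (hκ : κ ∈ Set.Icc (0 : ℝ) 1)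
    (hr₀ : ∀ g, g ≠ h → r g = 0) (hr : ∀ x a x', r h x a x' ∈ Set.Icc (0 : ℝ) 1)
    (hmax : ∀ x, Finset.univ.sup' Finset.univ_nonempty
      (fun a => ∑ x', (M.P h x a x').toReal * r h x a x') = if x = s then κ else 0) :
    IsOptimalValue M r (scaledReach M s h κ) where
  value_eq g x := by
    by_cases hgh : g = h
    · subst hgh
      simp_rw [funext (actionValue_scaledReach_self M s g κ x), hmax, scaledReach, maxReach_self]
      split_ifs <;> simp
    rw [funext (actionValue_scaledReach_of_ne M s (hr₀ g hgh) h κ x), Finset.sup'_univ_eq_ciSup,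
      ← Real.mul_iSup_of_nonneg hκ.1, ← ENNReal.toReal_iSup]
    · rcases lt_or_gt_of_ne hgh with hlt | hgt
      · rw [scaledReach, maxReach_of_lt M s hlt]
      · rw [scaledReach_of_gt M s hgt]
        simp [expect, maxReach_of_gt M s (Nat.lt_succ_of_lt hgt)]
    · exact fun a => ((expect_le _ (maxReach_le_one M s h _)).trans_lt ENNReal.one_lt_top).ne
  last x := scaledReach_of_gt M s h.isLt κ x
  mem_Icc g x a x' := by
    by_cases hgh : g = h
    · subst hgh
      rw [scaledReach_of_gt M s (Nat.lt_succ_self g), add_zero]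
      exact hr x a x'
    · rw [hr₀ g hgh, Pi.zero_apply, Pi.zero_apply, Pi.zero_apply, zero_add]
      exact scaledReach_mem_Icc M s hκ h _ x'

theorem isOptimalValue_stateReward (h : Fin H) :
    IsOptimalValue M (stateReward h s) (scaledReach M s h 1) := by
  classical
  refine isOptimalValue_scaledReach M s (by simp) (fun g hg => ?_) (fun x a x' => ?_) fun x => ?_
  · ext
    simp [stateReward, hg]
  · unfold stateReward
    split_ifs <;> simp
  · simp only [stateReward, true_and, ← Finset.sum_mul, sum_toReal_apply, one_mul,
      Finset.sup'_const]

theorem isOptimalValue_transitionReward (h : Fin H) (a : A) (s' : S) :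
    IsOptimalValue M (transitionReward h s a s')
      (scaledReach M s h (M.P h s a s').toReal) := by
  classical
  refine isOptimalValue_scaledReach M s
    ⟨ENNReal.toReal_nonneg, toReal_apply_le_one _ _⟩ (fun g hg => ?_) (fun x b x' => ?_) fun x => ?_
  · ext
    simp [transitionReward, hg]
  · unfold transitionReward
    split_ifs <;> simp
  · have hsum : ∀ b, ∑ x', (M.P h x b x').toReal * transitionReward h s a s' h x b x' =
        if x = s ∧ b = a then (M.P h s a s').toReal else 0 := fun b => by
      rw [Finset.sum_eq_single s' (fun x' _ hx' => by simp [transitionReward, hx']) (by simp)]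
      by_cases hxb : x = s ∧ b = a <;> simp [transitionReward, hxb]
    simp_rw [hsum]
    by_cases hx : x = s
    · simp only [hx, true_and, if_true]
      refine le_antisymm (Finset.sup'_le _ _ fun b _ => ?_) ?_
      · split_ifs <;> simp
      · exact Finset.le_sup'_of_le _ (Finset.mem_univ a) (if_pos rfl).ge
    · simp [hx]

end Reachability

section Constants

/-! ### The bonus and the number of episodes -/

theorem exists_threshold {f : ℕ → ℝ} (hf : MonotoneOn f (Set.Ici 1)) (hf₁ : 0 ≤ f 1)
    (hev : ∀ᶠ K : ℕ in Filter.atTop, f K ≤ K) :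
    ∃ K₀ : ℕ, 1 ≤ K₀ ∧ (K₀ : ℝ) ≤ 1 + f K₀ ∧ ∀ K : ℕ, K₀ ≤ K → f K ≤ K := by
  classical
  have hex : ∃ K₀ : ℕ, 1 ≤ K₀ ∧ ∀ K : ℕ, K₀ ≤ K → f K ≤ K := by
    obtain ⟨K₁, hK₁⟩ := Filter.eventually_atTop.1 hev
    exact ⟨max 1 K₁, le_max_left _ _, fun K hK => hK₁ K ((le_max_right _ _).trans hK)⟩
  obtain ⟨hpos, hall⟩ := Nat.find_spec hex
  refine ⟨Nat.find hex, hpos, ?_, hall⟩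
  rcases hpos.eq_or_lt with h1 | h1
  · rw [← h1, Nat.cast_one]
    linarith
  · obtain ⟨k, hk⟩ : ∃ k, Nat.find hex = k + 1 := Nat.exists_eq_add_of_le' hpos
    rw [hk] at hall h1 ⊢
    have hfail : (k : ℝ) < f k := by
      by_contra! hle
      refine Nat.find_min hex (by omega : k < Nat.find hex) ⟨by omega, fun K (hK : k ≤ K) => ?_⟩
      rcases hK.eq_or_lt with rfl | hlt
      · exact hle
      · exact hall K hlt
    have hgrow : f k ≤ f (k + 1) :=
      hf (Set.mem_Ici.2 (by omega)) (Set.mem_Ici.2 (by omega)) k.le_succ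
    push_cast
    linarith

theorem eventually_mul_log_mul_le (a : ℝ) {m : ℝ} (hm : 0 < m) :
    ∀ᶠ K : ℕ in Filter.atTop, a * Real.log (m * K) ≤ K := by
  have hlog : (fun K : ℕ => a * Real.log (m * K)) =o[Filter.atTop] fun K : ℕ => (K : ℝ) :=
    ((Real.isLittleO_log_id_atTop.comp_tendsto
      (tendsto_natCast_atTop_atTop.const_mul_atTop hm)).trans_isBigO
        (Asymptotics.isBigO_const_mul_self m _ _)).const_mul_left a
  filter_upwards [hlog.bound one_pos] with K hK
  rw [one_mul, Real.norm_natCast] at hK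
  exact (le_abs_self _).trans hK

variable {nS nA H K N : ℕ} {p : ℝ}

theorem exists_episodeBound_le {C : ℝ} (hC : 0 ≤ C) (hS : 0 < nS) (hA : 0 < nA) (hH : 0 < H)
    (hp : 0 < p) (hp₁ : p ≤ 1) (ε : ℝ) :
    ∃ K₀ : ℕ, 1 ≤ K₀ ∧ (K₀ : ℝ) ≤ 1 + episodeBound C nS nA H K₀ p ε ∧
      ∀ K : ℕ, K₀ ≤ K → episodeBound C nS nA H K p ε ≤ K := by
  set a : ℝ := C * ((H : ℝ) ^ 5 * nS * nA / ε ^ 2)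
  set m : ℝ := (nS : ℝ) * nA * H / p
  have ha : 0 ≤ a := by positivity
  have hm : 1 ≤ m := by
    rw [one_le_div hp]
    exact hp₁.trans (by exact_mod_cast Nat.mul_pos (Nat.mul_pos hS hA) hH)
  have hbound : ∀ K : ℕ, episodeBound C nS nA H K p ε = a * Real.log (m * K) := fun K => by
    rw [episodeBound, logFactor, div_mul_eq_mul_div]
    ring
  refine exists_threshold (fun K hK K' _ hKK' => ?_) ?_ ?_
  · have hK₀ : (0 : ℝ) < K := by exact_mod_cast Set.mem_Ici.1 hK
    rw [hbound, hbound]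
    gcongr
  · rw [hbound, Nat.cast_one, mul_one]
    exact mul_nonneg ha (Real.log_nonneg hm)
  · simp_rw [hbound]
    exact eventually_mul_log_mul_le a (zero_lt_one.trans_le hm)

theorem one_half_le_logFactor (hp : 0 < p) (hp₁ : p ≤ 1) (hn : 2 ≤ nS * nA * H * K) :
    1 / 2 ≤ logFactor nS nA H K p := by
  have hn' : (2 : ℝ) ≤ nS * nA * H * K := by exact_mod_cast hn
  have hlog : Real.log 2 ≤ logFactor nS nA H K p :=
    Real.log_le_log two_pos (hn'.trans (le_div_self (by positivity) hp hp₁))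
  linarith [Real.log_two_gt_d9]

theorem pos_of_two_le_mul (hn : 2 ≤ nS * nA * H * K) : ((0 < nS ∧ 0 < nA) ∧ 0 < H) ∧ 0 < K := by
  simpa only [CanonicallyOrderedAdd.mul_pos] using two_pos.trans_le hn

theorem two_mul_le_pow_three (hn : 2 ≤ nS * nA * H * K) :
    2 * H * nS ^ 2 * nA ≤ (nS * nA * H * K) ^ 3 := by
  obtain ⟨⟨⟨-, hA⟩, hH⟩, hK⟩ := pos_of_two_le_mul hn
  set n := nS * nA * H * K with hn_def
  calc 2 * H * nS ^ 2 * nA = 2 * (nS ^ 2 * nA ^ 1 * H ^ 1 * 1) := by ring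
    _ ≤ n * (nS ^ 2 * nA ^ 2 * H ^ 2 * K ^ 2) := by
      gcongr <;> first | assumption | exact Nat.one_le_pow _ _ hK | norm_num
    _ = n ^ 3 := by rw [hn_def]; ring

theorem log_le_three_mul_logFactor (hp : 0 < p) (hp₁ : p ≤ 1) (hn : 2 ≤ nS * nA * H * K)
    (hN : 0 < N) (hN' : N ≤ 2 * H * nS ^ 2 * nA) :
    Real.log N ≤ 3 * logFactor nS nA H K p := by
  have hn₀ : (0 : ℝ) < nS * nA * H * K := by exact_mod_cast two_pos.trans_le hn
  have hpow : (N : ℝ) ≤ (nS * nA * H * K) ^ 3 := by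
    exact_mod_cast hN'.trans (two_mul_le_pow_three hn)
  calc Real.log N ≤ Real.log (((nS : ℝ) * nA * H * K) ^ 3) :=
        Real.log_le_log (by exact_mod_cast hN) hpow
    _ = 3 * Real.log ((nS : ℝ) * nA * H * K) := by
        rw [Real.log_pow, Nat.cast_ofNat]
    _ ≤ 3 * logFactor nS nA H K p := by
        unfold logFactor
        gcongr
        exact le_div_self hn₀.le hp hp₁

theorem pow_five_mul_exp_le (hp : 0 < p) (hp₁ : p ≤ 1) (hn : 2 ≤ nS * nA * H * K) :
    ((nS : ℝ) * nA * H * K) ^ 5 * Real.exp (-(6 * logFactor nS nA H K p)) ≤ p := by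
  have hn' : (2 : ℝ) ≤ nS * nA * H * K := by exact_mod_cast hn
  rw [logFactor]
  set n : ℝ := (nS : ℝ) * nA * H * K
  have hn₀ : 0 < n := by linarith
  have hexp : Real.exp (6 * Real.log (n / p)) = (n / p) ^ 6 := by
    rw [← Real.exp_log (div_pos hn₀ hp), ← Real.exp_nat_mul, Real.exp_log (div_pos hn₀ hp)]
    norm_num
  calc n ^ 5 * Real.exp (-(6 * Real.log (n / p))) = p ^ 6 / n := by
        rw [Real.exp_neg, hexp]
        field_simp
    _ ≤ p ^ 6 := div_le_self (by positivity) (by linarith)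
    _ ≤ p := pow_le_of_le_one hp.le hp₁ (by norm_num)

theorem indicatorEventCount_le (hn : 2 ≤ nS * nA * H * K) :
    (H * nS + H * (nS * (nA * nS))) * (H * (nS * nA) * (K * H) * 2) ≤ (nS * nA * H * K) ^ 5 := by
  obtain ⟨⟨⟨hS, hA⟩, -⟩, hK⟩ := pos_of_two_le_mul hn
  have hSA : 1 ≤ nA * nS := Nat.mul_pos hA hS
  set n := nS * nA * H * K with hn_def
  calc (H * nS + H * (nS * (nA * nS))) * (H * (nS * nA) * (K * H) * 2)
      = 2 * (1 + nA * nS) * (nS ^ 2 * nA * H ^ 3 * K) := by ring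
    _ ≤ 2 * (nA * nS + nA * nS) * (nS ^ 2 * nA * H ^ 3 * K) := by gcongr
    _ = 2 ^ 2 * (nS ^ 3 * nA ^ 2 * H ^ 3 * K ^ 1) := by ring
    _ ≤ n ^ 2 * (nS ^ 3 * nA ^ 3 * H ^ 3 * K ^ 3) := by
        gcongr <;> first | assumption | norm_num
    _ = n ^ 5 := by rw [hn_def]; ring

/-- The scale `c √(H³ (log N + ι))` of the bonus, as a multiple of `1 / √t`. -/
def bonusScale (c : ℝ) (nS nA H K N : ℕ) (p : ℝ) : ℝ :=
  c * √((H : ℝ) ^ 3 * (Real.log N + logFactor nS nA H K p))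

theorem bonus_eq_sqrtBonus (c : ℝ) (nS nA H K N : ℕ) (p : ℝ) :
    bonus c nS nA H K N p = sqrtBonus (bonusScale c nS nA H K N p) := by
  funext t
  rw [bonus, sqrtBonus, bonusScale, Real.sqrt_div' _ (Nat.cast_nonneg t), mul_div_assoc]

theorem bonusScale_nonneg {c : ℝ} (hc : 0 ≤ c) : 0 ≤ bonusScale c nS nA H K N p :=
  mul_nonneg hc (Real.sqrt_nonneg _)

theorem le_sq_bonusScale_div (hH : 0 < H) (hι : 0 ≤ logFactor nS nA H K p) :
    6 * logFactor nS nA H K p ≤ bonusScale 5 nS nA H K N p ^ 2 / (4 * H) := by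
  have hH' : (1 : ℝ) ≤ H := by exact_mod_cast hH
  have hlogN := Real.log_natCast_nonneg N
  rw [bonusScale, mul_pow, Real.sq_sqrt (by positivity), le_div_iff₀ (by positivity)]
  set ι := logFactor nS nA H K p
  have hmul : (H : ℝ) * ι ≤ (H : ℝ) ^ 3 * (Real.log N + ι) := by
    gcongr
    · exact le_self_pow₀ hH' (by norm_num)
    · linarith
  nlinarith [mul_nonneg (Nat.cast_nonneg (α := ℝ) H) hι]

theorem bonusScale_le (hlog : Real.log N ≤ 3 * logFactor nS nA H K p) :
    bonusScale 5 nS nA H K N p ≤ 10 * √((H : ℝ) ^ 3 * logFactor nS nA H K p) := by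
  set ι := logFactor nS nA H K p
  calc bonusScale 5 nS nA H K N p ≤ 5 * √(2 ^ 2 * ((H : ℝ) ^ 3 * ι)) := by
        rw [bonusScale, mul_left_comm]
        gcongr
        linarith
    _ = 10 * √((H : ℝ) ^ 3 * ι) := by
        rw [Real.sqrt_mul (by norm_num), Real.sqrt_sq zero_le_two]
        ring

theorem mul_sqrt_mul_sqrt_le {Y h ι K ε : ℝ} (hY : 0 ≤ Y) (hh : 0 ≤ h) (hι : 0 ≤ ι) (hK : 0 ≤ K)
    (hε : 0 ≤ ε) (hKε : 10 ^ 6 * (h ^ 5 * Y * ι) ≤ K * ε ^ 2) :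
    10 ^ 3 * (√(h ^ 3 * ι) * (h * √(Y * K))) ≤ ε * K := by
  refine (pow_le_pow_iff_left₀ (by positivity) (by positivity) two_ne_zero).1 ?_
  calc (10 ^ 3 * (√(h ^ 3 * ι) * (h * √(Y * K)))) ^ 2 = 10 ^ 6 * (h ^ 5 * Y * ι) * K := by
        simp only [mul_pow, Real.sq_sqrt (by positivity : 0 ≤ h ^ 3 * ι),
          Real.sq_sqrt (by positivity : 0 ≤ Y * K)]
        ring
    _ ≤ K * ε ^ 2 * K := by gcongr
    _ = (ε * K) ^ 2 := by ring

theorem mul_sq_add_mul_sqrt_le {Y h ι K β ε : ℝ} (hY : 0 ≤ Y) (hh : 1 ≤ h) (hι : 1 / 2 ≤ ι)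
    (hK : 0 ≤ K) (hε : 0 ≤ ε) (hεh : ε ≤ h) (hβ : β ≤ 10 * √(h ^ 3 * ι))
    (hKε : 10 ^ 6 * (h ^ 5 * Y * ι) ≤ K * ε ^ 2) :
    3 * (Y * h ^ 2) + 12 * β * (h * √(Y * K)) ≤ ε * K := by
  have hh₀ : 0 < h := by linarith
  have hsqrt : 12 * β * (h * √(Y * K)) ≤ 120 * (√(h ^ 3 * ι) * (h * √(Y * K))) := by
    calc 12 * β * (h * √(Y * K)) ≤ 12 * (10 * √(h ^ 3 * ι)) * (h * √(Y * K)) := by gcongr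
      _ = 120 * (√(h ^ 3 * ι) * (h * √(Y * K))) := by ring
  have hlin : 5 * 10 ^ 5 * (Y * h ^ 2) ≤ ε * K := by
    refine le_of_mul_le_mul_right ?_ hh₀
    calc 5 * 10 ^ 5 * (Y * h ^ 2) * h = 10 ^ 6 * (h ^ 3 * Y * (1 / 2)) := by ring
      _ ≤ 10 ^ 6 * (h ^ 5 * Y * ι) := by
          gcongr
          norm_num
      _ ≤ K * ε ^ 2 := hKε
      _ = ε * K * ε := by ring
      _ ≤ ε * K * h := by gcongr
  linarith [mul_sqrt_mul_sqrt_le hY hh₀.le (by linarith) hK hε hKε, mul_nonneg hε hK]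

theorem abs_div_sub_le {d P u v ε : ℝ} (hd : 0 < d) (hP : P ∈ Set.Icc (0 : ℝ) 1)
    (hu : u ∈ Set.Icc (P * d) (P * d + ε)) (hv : v ∈ Set.Icc d (d + ε)) :
    |u / v - P| ≤ ε / d := by
  have hv₀ : 0 < v := hd.trans_le hv.1
  have hε : 0 ≤ ε := by linarith [hv.1, hv.2]
  rw [div_sub' hv₀.ne', abs_div, abs_of_pos hv₀, mul_comm v]
  refine div_le_div₀ hε (abs_le.2 ⟨?_, ?_⟩) hd hv.1
  · linarith [hu.1, mul_le_mul_of_nonneg_left hv.2 hP.1, mul_le_mul_of_nonneg_right hP.2 hε]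
  · linarith [hu.2, mul_le_mul_of_nonneg_left hv.1 hP.1]

end Constants

section Estimates

/-! ### The estimates -/

variable {S A : Type*} {H : ℕ} [Fintype A] [Nonempty A]

theorem modelEstimate_one [Subsingleton S] (M : EpisodicMDP S A H) (b : ℕ → ℝ)
    (D : List (List (Transition S A H))) (h : Fin H) (s : S) (a : A) (s' : S) :
    modelEstimate b 1 D M.start h s a s' = (M.P h s a s').toReal := by
  have hvalue : ∀ r, averageValue b 1 D r h.pos M.start = H := fun r => by
    simp [averageValue, learn, Tables.value, Tables.init]
  have hH : (H : ℝ) ≠ 0 := Nat.cast_ne_zero.2 h.pos.ne'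
  have hP : (M.P h s a s').toReal = 1 := by
    have := Fintype.ofFinite S
    rw [← sum_toReal_apply (M.P h s a), Fintype.sum_subsingleton _ s']
  rw [modelEstimate, hvalue, hvalue, div_self hH, hP]

theorem modelEstimate_of_lt_two [Fintype S] (M : EpisodicMDP S A H) (b : ℕ → ℝ) {K : ℕ}
    (hK : 0 < K) (hn : Fintype.card S * Fintype.card A * H * K < 2)
    (D : List (List (Transition S A H))) (h : Fin H) (s : S) (a : A) (s' : S) :
    modelEstimate b K D M.start h s a s' = (M.P h s a s').toReal := by
  have hpos : 0 < Fintype.card S * Fintype.card A * H * K := Nat.mul_pos (Nat.mul_pos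
    (Nat.mul_pos (Fintype.card_pos_iff.2 ⟨s⟩) Fintype.card_pos) h.pos) hK
  have hone : Fintype.card S * Fintype.card A * H * K = 1 := by omega
  obtain ⟨⟨⟨hS, -⟩, -⟩, rfl⟩ := by simpa only [mul_eq_one] using hone
  have := Fintype.card_le_one_iff_subsingleton.1 hS.le
  exact modelEstimate_one M b D h s a s'

variable [Fintype S] {M : EpisodicMDP S A H} {b : ℕ → ℝ} {K : ℕ}
  {D : List (List (Transition S A H))} {ε : ℝ}

theorem IsOptimalValue.averageValue_mem_Icc {r : Fin H → S → A → S → ℝ} {V : ℕ → S → ℝ}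
    (hV : IsOptimalValue M r V) (hb : AntitoneOn b (Set.Ici 1)) (hK : 0 < K)
    (hD : IsNoiseBounded M r V b D.flatten)
    (hε : ∑ k ∈ Finset.range K, (pseudoTables b (D.take k).flatten).valueAt 0 M.start ≤ ε * K)
    (hH : 0 < H) :
    averageValue b K D r hH M.start ∈ Set.Icc (V 0 M.start) (V 0 M.start + ε) := by
  have hK' : (0 : ℝ) < K := by exact_mod_cast hK
  have htake : ∀ k, IsNoiseBounded M r V b (D.take k).flatten := fun k =>
    IsNoiseBounded.of_append (L' := (D.drop k).flatten) (by
      rwa [← List.flatten_append, List.take_append_drop])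
  have hvalue : averageValue b K D r hH M.start =
      (∑ k ∈ Finset.range K, (learn b r (D.take k).flatten).valueAt 0 M.start) / K := by
    simp only [averageValue, Tables.valueAt, dif_pos hH]
  have hconst : ∑ _k ∈ Finset.range K, V 0 M.start = V 0 M.start * K := by
    rw [Finset.sum_const, Finset.card_range, nsmul_eq_mul, mul_comm]
  rw [hvalue, Set.mem_Icc, le_div_iff₀ hK', div_le_iff₀ hK', add_mul, ← hconst]
  constructor
  · exact Finset.sum_le_sum fun k _ => hV.le_valueAt_learn hb (htake k) (Nat.zero_le _) _
  · refine (Finset.sum_le_sum fun k _ =>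
      hV.valueAt_learn_le hb (htake k) (Nat.zero_le _) _).trans ?_
    rw [Finset.sum_add_distrib]
    gcongr

/-- The event on which the estimates are accurate: the averaged noise is bounded by the bonus for
all indicator rewards. -/
def IsIndicatorNoiseBounded (M : EpisodicMDP S A H) (b : ℕ → ℝ)
    (L : List (Transition S A H)) : Prop :=
  (∀ h s, IsNoiseBounded M (stateReward h s) (scaledReach M s h 1) b L) ∧
    ∀ h s a s', IsNoiseBounded M (transitionReward h s a s')
      (scaledReach M s h (M.P h s a s').toReal) b L

theorem IsIndicatorNoiseBounded.abs_modelEstimate_sub_le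
    (hD : IsIndicatorNoiseBounded M b D.flatten) (hb : AntitoneOn b (Set.Ici 1)) (hK : 0 < K)
    (hε : ∑ k ∈ Finset.range K, (pseudoTables b (D.take k).flatten).valueAt 0 M.start ≤ ε * K)
    {h : Fin H} {s : S} (hs : 0 < reachability M h s) (a : A) (s' : S) :
    |modelEstimate b K D M.start h s a s' - (M.P h s a s').toReal| ≤ ε / reachability M h s := by
  have hstate := (isOptimalValue_stateReward M s h).averageValue_mem_Icc hb hK (hD.1 h s) hε h.pos
  have htrans := (isOptimalValue_transitionReward M s h a s').averageValue_mem_Icc hb hK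
    (hD.2 h s a s') hε h.pos
  rw [scaledReach_start, one_mul] at hstate
  rw [scaledReach_start] at htrans
  exact abs_div_sub_le hs ⟨ENNReal.toReal_nonneg, toReal_apply_le_one _ _⟩ htrans hstate

theorem toOuterMeasure_not_isIndicatorNoiseBounded_le (act : ActionRule S A H) (K : ℕ) {β : ℝ}
    (hβ : 0 ≤ β) :
    (explore M act K).toOuterMeasure {D | ¬IsIndicatorNoiseBounded M (sqrtBonus β) D.flatten} ≤
      (Fintype.card (Fin H × S) + Fintype.card (Fin H × S × A × S)) *
        (Fintype.card ((Fin H × S × A) × Fin (K * H)) *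
          (2 * ENNReal.ofReal (Real.exp (-(β ^ 2 / (4 * H)))))) := by
  have hstate := toOuterMeasure_exists_le (explore M act K) fun i : Fin H × S =>
    (isOptimalValue_stateReward M i.2 i.1).toOuterMeasure_not_isNoiseBounded_le act K hβ
  have htrans := toOuterMeasure_exists_le (explore M act K) fun i : Fin H × S × A × S =>
    (isOptimalValue_transitionReward M i.2.1 i.1 i.2.2.1
      i.2.2.2).toOuterMeasure_not_isNoiseBounded_le act K hβ
  rw [add_mul]
  refine le_trans (MeasureTheory.measure_mono fun D hD => ?_)
    ((MeasureTheory.measure_union_le _ _).trans (add_le_add hstate htrans))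
  simpa [IsIndicatorNoiseBounded, imp_iff_not_or, not_and_or] using hD

variable {N : ℕ} {p : ℝ}

theorem toOuterMeasure_not_isIndicatorNoiseBounded_bonusScale_le (act : ActionRule S A H)
    (hp : 0 < p) (hp₁ : p ≤ 1) (hn : 2 ≤ Fintype.card S * Fintype.card A * H * K) :
    (explore M act K).toOuterMeasure {D | ¬IsIndicatorNoiseBounded M
      (sqrtBonus (bonusScale 5 (Fintype.card S) (Fintype.card A) H K N p)) D.flatten} ≤
        ENNReal.ofReal p := by
  have hH : 0 < H := (pos_of_two_le_mul hn).1.2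
  refine (toOuterMeasure_not_isIndicatorNoiseBounded_le act K
    (bonusScale_nonneg (by norm_num))).trans ?_
  set β := bonusScale 5 (Fintype.card S) (Fintype.card A) H K N p
  set nS := Fintype.card S
  set nA := Fintype.card A
  set ι := logFactor nS nA H K p
  have hexp : Real.exp (-(β ^ 2 / (4 * H))) ≤ Real.exp (-(6 * ι)) := by
    gcongr
    exact le_sq_bonusScale_div hH (by linarith [one_half_le_logFactor hp hp₁ hn])
  simp only [Fintype.card_prod, Fintype.card_fin]
  calc _ = ((H * nS + H * (nS * (nA * nS))) * (H * (nS * nA) * (K * H) * 2) : ℕ) *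
          ENNReal.ofReal (Real.exp (-(β ^ 2 / (4 * H)))) := by
        push_cast
        ring
    _ ≤ ((nS * nA * H * K) ^ 5 : ℕ) * ENNReal.ofReal (Real.exp (-(6 * ι))) := by
        gcongr
        exact indicatorEventCount_le hn
    _ = ENNReal.ofReal (((nS : ℝ) * nA * H * K) ^ 5 * Real.exp (-(6 * ι))) := by
        rw [← ENNReal.ofReal_natCast, ← ENNReal.ofReal_mul (Nat.cast_nonneg _)]
        push_cast
        rfl
    _ ≤ ENNReal.ofReal p := ENNReal.ofReal_le_ofReal (pow_five_mul_exp_le hp hp₁ hn)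

theorem sum_valueAt_pseudoTables_bonusScale_le {act : ActionRule S A H}
    (hact : IsGreedy (sqrtBonus (bonusScale 5 (Fintype.card S) (Fintype.card A) H K N p)) act)
    (hι : 1 / 2 ≤ logFactor (Fintype.card S) (Fintype.card A) H K p)
    (hlog : Real.log N ≤ 3 * logFactor (Fintype.card S) (Fintype.card A) H K p) (hε : 0 < ε)
    (hK : episodeBound (10 ^ 6) (Fintype.card S) (Fintype.card A) H K p ε ≤ K)
    (hH : 0 < H) (hD : D ∈ (explore M act K).support) :
    ∑ k ∈ Finset.range K, (pseudoTables (sqrtBonus (bonusScale 5 (Fintype.card S) (Fintype.card A)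
      H K N p)) (D.take k).flatten).valueAt 0 M.start ≤ ε * K := by
  rcases le_total ε H with hεH | hεH
  · refine (sum_valueAt_pseudoTables_le (bonusScale_nonneg (by norm_num)) hact hD).trans ?_
    refine mul_sq_add_mul_sqrt_le (by positivity) (by exact_mod_cast hH) hι (Nat.cast_nonneg _)
      hε.le hεH (bonusScale_le hlog) ?_
    rw [episodeBound, ← mul_div_assoc, div_le_iff₀ (by positivity)] at hK
    linarith
  · calc _ ≤ ∑ _k ∈ Finset.range K, (H : ℝ) := Finset.sum_le_sum fun k _ => Tables.valueAt_le _ _ _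
      _ = H * K := by rw [Finset.sum_const, Finset.card_range, nsmul_eq_mul, mul_comm]
      _ ≤ ε * K := by gcongr

end Estimates

end UCBZero

end

open UCBZero

theorem theorem3 :
    ∃ c : ℝ, 0 < c ∧ ∃ C : ℝ, 0 < C ∧
      ∀ (S A : Type*) [Fintype S] [Fintype A] [Nonempty A] (H : ℕ), 0 < H →
      ∀ (M : UCBZero.EpisodicMDP S A H) (p ε : ℝ), 0 < p → p < 1 → 0 < ε →
        (∃ K₀ : ℕ, 1 ≤ K₀ ∧
          (K₀ : ℝ) ≤ 1 + UCBZero.episodeBound C (Fintype.card S) (Fintype.card A) H K₀ p ε ∧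
          ∀ K : ℕ, K₀ ≤ K →
            UCBZero.episodeBound C (Fintype.card S) (Fintype.card A) H K p ε ≤ (K : ℝ)) ∧
        ∀ (N : ℕ), 1 ≤ N → N ≤ 2 * H * Fintype.card S ^ 2 * Fintype.card A →
        ∀ (K : ℕ), 1 ≤ K →
          UCBZero.episodeBound C (Fintype.card S) (Fintype.card A) H K p ε ≤ (K : ℝ) →
        ∀ b : ℕ → ℝ, b = UCBZero.bonus c (Fintype.card S) (Fintype.card A) H K N p →
        ∀ act : UCBZero.ActionRule S A H, UCBZero.IsGreedy b act →
          ENNReal.ofReal (1 - p) ≤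
            (UCBZero.explore M act K).toOuterMeasure
              {D | ∀ (h : Fin H) (s : S) (a : A) (s' : S), 0 < UCBZero.reachability M h s →
                |UCBZero.modelEstimate b K D M.start h s a s' - (M.P h s a s').toReal| ≤
                  ε / UCBZero.reachability M h s} := by
  refine ⟨5, by norm_num, 10 ^ 6, by norm_num, ?_⟩
  intro S A _ _ _ H hH M p ε hp hp₁ hε
  have hS : 0 < Fintype.card S := Fintype.card_pos_iff.2 ⟨M.start⟩
  have hA : 0 < Fintype.card A := Fintype.card_pos
  refine ⟨exists_episodeBound_le (by norm_num) hS hA hH hp hp₁.le ε, ?_⟩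
  rintro N hN hNle K hK hKε _ rfl act hact
  rw [bonus_eq_sqrtBonus] at hact ⊢
  refine ofReal_one_sub_le_toOuterMeasure _ hp.le ?_
  rcases Nat.lt_or_ge (Fintype.card S * Fintype.card A * H * K) 2 with hn | hn
  · refine (PMF.toOuterMeasure_mono _ (t := ∅) ?_).trans (by simp)
    rintro D ⟨hbad, -⟩
    exact hbad fun h s a s' hs => by
      rw [modelEstimate_of_lt_two M _ hK hn, sub_self, abs_zero]
      positivity
  · refine (PMF.toOuterMeasure_mono _ ?_).trans
      (toOuterMeasure_not_isIndicatorNoiseBounded_bonusScale_le (N := N) act hp hp₁.le hn)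
    rintro D ⟨hbad, hD⟩ hgood
    have hι := one_half_le_logFactor hp hp₁.le hn
    have hlog := log_le_three_mul_logFactor hp hp₁.le hn hN hNle
    exact hbad fun h s a s' hs => hgood.abs_modelEstimate_sub_le
      (antitoneOn_sqrtBonus (bonusScale_nonneg (by norm_num))) hK
      (sum_valueAt_pseudoTables_bonusScale_le hact hι hlog hε hKε hH hD) hs a s'
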